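/- For each $n\ge1$ let $\mathbf y=X\beta^0+\epsilon\in\mathbb R^n$, where $\epsilon\sim N(0,\sigma_0^2I_n)$ with $\sigma_0>0$, $X$ is an $n\times n$ design matrix (so $p=n$), either deterministic or random and independent of $\epsilon$, with $X^TX=nI_n$ almost surely, and $\beta^0=\beta^{0,n}\in\mathbb R^n$ is the deterministic true coefficient vector. All random variables live on one probability space. A model is a subset $\gamma\subseteq\{1,\dots,n\}$; the true model is $\gamma^0=\{j:\beta^0_j\ne0\}$. Given $\nu>0$ (fixed) and $\phi_n>0$, consider the Bayesian model $$\mathbf y\mid\beta,\sigma^2\sim N(X\beta,\sigma^2I_n),\qquad \beta_j\mid\gamma,\sigma^2\ \overset{\text{indep.}}{\sim}\ \begin{cases}N(0,\phi_n\sigma^2)& j\in\gamma\\ \delta_0& j\notin\gamma\end{cases},\qquad 1/\sigma^2\sim\chi^2_\nu,\qquad p(\gamma)=2^{-n}\ \text{for all }\gamma,$$ and let $p(\gamma\mid Z)$, $Z=(\mathbf y,X)$, denote the resulting posterior probability of $\gamma$. Posterior model consistency (PMC) means $p(\gamma^0\mid Z)\to1$ in probability. Assume that for some constants $\delta_1>1$,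 $c_1>0$ and a fixed integer $s>0$, for all large $n$: $|\gamma^0|=s$ and $\min_{j\in\gamma^0}|\beta^0_j|\ge\psi_n$, where $\psi_n\ge0$ and $\psi_n^2=c_1n^{1+\delta_1}(\log n)^2$; and assume $\|\beta^0\|_2^2=O(\psi_n^2)$. Then, as $n\to\infty$: (a) Suppose $\phi_n=c_2n^{\delta_2}$ for constants $c_2>0$ and $\delta_2\in\mathbb R$. (i) If $-1<\delta_2\le1$, then $\max_{\gamma\ne\gamma^0}p(\gamma\mid Z)/p(\gamma^0\mid Z)\to0$ in probability, but PMC does not hold. Specifically, if $-1<\delta_2<1$, then $p(\gamma^0\mid Z)\to0$ almost surely; if $\delta_2=1$, then there is a constant $0<c_0<1$ such that $\limsup_np(\gamma^0\mid Z)\le c_0$ almost surely. (ii) If $1<\delta_2\le\delta_1$, then $p(\gamma^0\mid Z)\to1$ in probability. (b) If $n^{n\log n}=O(\phi_n)$, then $p(\emptyset\mid Z)/p(\gamma^0\mid Z)\to\infty$ in probability, where $\emptyset$ is the null model, and $p(\gamma^0\mid Z)\to0$ in probability. (c) If $n\phi_n\to\eta\in[0,\infty)$, then almost surely $\liminf_n\max_{\gamma\ne\gamma^0}p(\gamma\mid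 Z)/p(\gamma^0\mid Z)\ge(1+\eta)^{-1/2}$ and $\lim_np(\gamma^0\mid Z)=0$. -/

import Mathlib

open MeasureTheory ProbabilityTheory Filter Topology Asymptotics
open scoped Matrix

noncomputable section

namespace BVS

/-- The state vector of `β`, encoded as the set of indices `j` with `β j ≠ 0`.
A model is a set of indices in `Fin p`. -/
def stateVector {p : ℕ} (β : Fin p → ℝ) : Finset (Fin p) :=
  Finset.univ.filter fun j => β j ≠ 0

/-- The chi-squared distribution with `ν` degrees of freedom, i.e. the gamma distribution with
shape `ν / 2` and rate `1 / 2`. -/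
def chiSquared (ν : ℝ) : Measure ℝ := gammaMeasure (ν / 2) (1 / 2)

/-- The prior of the coefficient vector given the model `γ` and the error variance `v = σ²`: the
coordinates are independent, the `j`-th one is `N(0, c j * σ²)` if `j ∈ γ`, and it is a point mass
at zero otherwise. -/
def coefPrior {p : ℕ} (c : Fin p → ℝ) (γ : Finset (Fin p)) (v : ℝ) : Measure (Fin p → ℝ) :=
  Measure.pi fun j => if j ∈ γ then gaussianReal 0 (c j * v).toNNReal else Measure.dirac 0

/-- The density at `y` of `N(X β, σ² I_n)`, where `v = σ²`. -/
def likelihood {n p : ℕ} (X : Matrix (Fin n) (Fin p) ℝ) (β : Fin p → ℝ) (v : ℝ)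
    (y : Fin n → ℝ) : ℝ :=
  ∏ i, gaussianPDFReal ((X *ᵥ β) i) v.toNNReal (y i)

/-- The marginal density of `y` given the model `γ` (and the design `X`): the coefficients and the
error variance are integrated out; the variable `t` is `1 / σ²`, which is chi-squared. -/
def marginalLikelihood {n p : ℕ} (ν : ℝ) (c : Fin p → ℝ) (X : Matrix (Fin n) (Fin p) ℝ)
    (y : Fin n → ℝ) (γ : Finset (Fin p)) : ℝ :=
  ∫ t, ∫ β, likelihood X β t⁻¹ y ∂(coefPrior c γ t⁻¹) ∂(chiSquared ν)

/-- The posterior probability `p(γ | Z)`, `Z = (y, X)`, of the model `γ` when the models have prior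
probabilities `prior`. -/
def posteriorProb {n p : ℕ} (ν : ℝ) (c : Fin p → ℝ) (prior : Finset (Fin p) → ℝ)
    (X : Matrix (Fin n) (Fin p) ℝ) (y : Fin n → ℝ) (γ : Finset (Fin p)) : ℝ :=
  prior γ * marginalLikelihood ν c X y γ / ∑ γ', prior γ' * marginalLikelihood ν c X y γ'

/-- The posterior odds ratio `p(γ | Z) / p(γ₀ | Z)` in favor of `γ`. -/
def posteriorOdds {n p : ℕ} (ν : ℝ) (c : Fin p → ℝ) (prior : Finset (Fin p) → ℝ)
    (X : Matrix (Fin n) (Fin p) ℝ) (y : Fin n → ℝ) (γ₀ γ : Finset (Fin p)) : ℝ :=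
  posteriorProb ν c prior X y γ / posteriorProb ν c prior X y γ₀

/-- `max_{γ ≠ γ₀} p(γ | Z) / p(γ₀ | Z)`; the supremum is over a finite set, which is nonempty
whenever `p ≥ 1`. -/
def maxPosteriorOdds {n p : ℕ} (ν : ℝ) (c : Fin p → ℝ) (prior : Finset (Fin p) → ℝ)
    (X : Matrix (Fin n) (Fin p) ℝ) (y : Fin n → ℝ) (γ₀ : Finset (Fin p)) : ℝ :=
  ⨆ γ : {γ : Finset (Fin p) // γ ≠ γ₀}, posteriorOdds ν c prior X y γ₀ γ

/-- The flat prior `p(γ) = 2^{-p}` on the `2^p` models. -/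
def flatPrior (p : ℕ) : Finset (Fin p) → ℝ := fun _ => (2 ^ p)⁻¹

/-- Divergence to `+∞` in probability. -/
def TendstoInProbAtTop {Ω : Type*} [MeasurableSpace Ω] (P : Measure Ω) (f : ℕ → Ω → ℝ) : Prop :=
  ∀ M : ℝ, Tendsto (fun n => P {ω | f n ω ≤ M}) atTop (𝓝 0)

end BVS

end

noncomputable section

namespace BVS

/-! The orthogonal square design decouples the coordinates: the score is `w = √n β⁰ + ξ` with
Gaussian noise `ξ`, and integrating out `β` and `σ²` gives `marginalLikelihood_eq`. Up to a common
constant the weight of `γ` is `(1+a)^(-|γ|/2) D(γ)^(-(n+ν)/2)`, where `a = nφ` and `D` is one plus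
the sum of the `w j ^ 2`, those in `γ` being divided by `1+a`. Everything is a comparison of these
weights.

Failure of consistency is deterministic. Adding an index can only decrease `D`, so it costs at most
a factor `(1+a)^(-1/2)`. The `n - s` one-index enlargements of `γ⁰` therefore force `p(γ⁰|Z) ≤ (1 +
(n-s)/√(1+nφ))⁻¹` (`posteriorProb_le`). The behaviour of `(1+nφ)/n²` decides the limit, and the
almost sure claims of (a)(i) and (c) follow.

The upper bounds hold on the event that every noise score is at most `log n`, whose probability
tends to 1 by Chernoff and a union bound. There `posteriorOdds_le` separates two kinds of model. For
`γ ⊇ γ⁰` the shrunken signal keeps `D` so large that each superfluous index changes `D^(-(n+ν)/2)`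
by a bounded factor only, so the odds are at most `θ^k` with `k = |γ \ γ⁰|` and `θ` of order
`(1+nφ)^(-1/2)`; this needs `δ₂ ≤ δ₁`. If `γ` misses a signal, `D(γ)` exceeds `D(γ⁰)` by a factor of
order `1+nφ`, and the power `(n+ν)/2` makes the odds small enough to beat all `2^n` models. The odds
then sum to at most `exp(nθ) + o(1)`, which tends to 1 when `φ/n → ∞`; the largest competing odds
vanish as soon as `nφ → ∞`.

In (b) the size penalty paid by `γ⁰` is so severe that the null model wins, although its dispersion
is larger: that dispersion is polynomial in `n`, and its power `(n+ν)/2` is beaten by `√φ`. -/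

/-- The normalized score vector `n^{-1/2} Xᵀ y`. -/
def score {n : ℕ} (X : Matrix (Fin n) (Fin n) ℝ) (y : Fin n → ℝ) : Fin n → ℝ :=
  fun j => (√(n : ℝ))⁻¹ * (Xᵀ *ᵥ y) j

/-- One plus the sum of squares of `w`, where the coordinates in `γ` are shrunk by `1 + a`. -/
def dispersion {n : ℕ} (a : ℝ) (w : Fin n → ℝ) (γ : Finset (Fin n)) : ℝ :=
  1 + ∑ j, w j ^ 2 / (if j ∈ γ then 1 + a else 1)

/-- The closed form of the marginal likelihood under an orthogonal design, up to a constant that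
does not depend on the model. -/
def modelWeight {n : ℕ} (q a : ℝ) (w : Fin n → ℝ) (γ : Finset (Fin n)) : ℝ :=
  (√(1 + a))⁻¹ ^ γ.card * dispersion a w γ ^ (-q)

/-! ### Decoupling the coordinates under an orthogonal design -/

section OrthogonalDesign

variable {n : ℕ} {X : Matrix (Fin n) (Fin n) ℝ}

/-- This is where `p = n` matters: a one-sided inverse of a square matrix is two-sided, so the score
map is an isometry and no residual sum of squares is left over. -/
theorem mul_transpose_of_transpose_mul (hn : 1 ≤ n)
    (hX : Xᵀ * X = (n : ℝ) • (1 : Matrix (Fin n) (Fin n) ℝ)) :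
    X * Xᵀ = (n : ℝ) • (1 : Matrix (Fin n) (Fin n) ℝ) := by
  have hn' : (n : ℝ) ≠ 0 := by positivity
  have h : ((n : ℝ)⁻¹ • Xᵀ) * X = 1 := by
    rw [Matrix.smul_mul, hX, smul_smul, inv_mul_cancel₀ hn', one_smul]
  have h' := mul_eq_one_comm.1 h
  rw [Matrix.mul_smul] at h'
  rw [← h', smul_smul, mul_inv_cancel₀ hn', one_smul]

theorem sum_score_sq (hn : 1 ≤ n) (hX : Xᵀ * X = (n : ℝ) • (1 : Matrix (Fin n) (Fin n) ℝ))
    (u : Fin n → ℝ) : ∑ j, score X u j ^ 2 = ∑ i, u i ^ 2 := by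
  have hn' : (n : ℝ) ≠ 0 := by positivity
  have h1 : (Xᵀ *ᵥ u) ⬝ᵥ (Xᵀ *ᵥ u) = n * (u ⬝ᵥ u) := by
    rw [Matrix.dotProduct_mulVec, Matrix.vecMul_transpose, Matrix.mulVec_mulVec,
      mul_transpose_of_transpose_mul hn hX, Matrix.smul_mulVec, Matrix.one_mulVec,
      smul_dotProduct, smul_eq_mul]
  have h2 : ∑ j, score X u j ^ 2 = (n : ℝ)⁻¹ * ((Xᵀ *ᵥ u) ⬝ᵥ (Xᵀ *ᵥ u)) := by
    simp only [score, dotProduct, mul_pow, inv_pow, Real.sq_sqrt (Nat.cast_nonneg n),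
      Finset.mul_sum]
    exact Finset.sum_congr rfl fun j _ => by ring
  rw [h2, h1, ← mul_assoc, inv_mul_cancel₀ hn', one_mul]
  simp only [dotProduct, sq]

theorem score_add (X : Matrix (Fin n) (Fin n) ℝ) (u v : Fin n → ℝ) (j : Fin n) :
    score X (u + v) j = score X u j + score X v j := by
  simp only [score, Matrix.mulVec_add, Pi.add_apply]
  ring

theorem score_sub (X : Matrix (Fin n) (Fin n) ℝ) (u v : Fin n → ℝ) (j : Fin n) :
    score X (u - v) j = score X u j - score X v j := by
  simp only [score, Matrix.mulVec_sub, Pi.sub_apply]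
  ring

theorem score_mulVec (hX : Xᵀ * X = (n : ℝ) • (1 : Matrix (Fin n) (Fin n) ℝ))
    (β : Fin n → ℝ) (j : Fin n) : score X (X *ᵥ β) j = √(n : ℝ) * β j := by
  rcases eq_or_ne (n : ℝ) 0 with h0 | h0
  · simp [score, h0]
  have hs : √(n : ℝ) ≠ 0 := by positivity
  have hsq := Real.mul_self_sqrt (Nat.cast_nonneg (α := ℝ) n)
  simp only [score, Matrix.mulVec_mulVec, hX, Matrix.smul_mulVec, Matrix.one_mulVec,
    Pi.smul_apply, smul_eq_mul]
  rw [← mul_assoc]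
  congr 1
  field_simp
  nlinarith

theorem prod_gaussianPDFReal (m : Fin n → ℝ) (v : NNReal) (x : Fin n → ℝ) :
    ∏ i, gaussianPDFReal (m i) v (x i) =
      (√(2 * Real.pi * v))⁻¹ ^ n * Real.exp (-(∑ i, (x i - m i) ^ 2) / (2 * v)) := by
  simp only [gaussianPDFReal, Finset.prod_mul_distrib, Finset.prod_const, Finset.card_univ,
    Fintype.card_fin, ← Real.exp_sum]
  rw [neg_div, Finset.sum_div, ← Finset.sum_neg_distrib]
  simp only [neg_div]

theorem likelihood_eq_prod (hn : 1 ≤ n)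
    (hX : Xᵀ * X = (n : ℝ) • (1 : Matrix (Fin n) (Fin n) ℝ)) (β : Fin n → ℝ) (v : ℝ)
    (y : Fin n → ℝ) :
    likelihood X β v y = ∏ j, gaussianPDFReal (√(n : ℝ) * β j) v.toNNReal (score X y j) := by
  rw [likelihood, prod_gaussianPDFReal, prod_gaussianPDFReal]
  congr 4
  -- The isometry applied to the residual turns its sum of squares into a sum of one-coordinate
  -- terms.
  have := sum_score_sq hn hX (y - X *ᵥ β)
  simp only [score_sub, score_mulVec hX, Pi.sub_apply] at this
  exact this.symm

end OrthogonalDesign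

/-! ### Closed form of the marginal likelihood and the posterior -/

/-- Completing the square in `b`: prior times likelihood equals marginal times posterior, so
integrating over `b` leaves only the marginal factor. -/
theorem gaussianPDFReal_mul_gaussianPDFReal {r φ v : ℝ} (hφ : 0 < φ) (hv : 0 < v) (w b : ℝ) :
    gaussianPDFReal 0 (φ * v).toNNReal b * gaussianPDFReal (r * b) v.toNNReal w =
      gaussianPDFReal 0 ((1 + r ^ 2 * φ) * v).toNNReal w *
        gaussianPDFReal (r * φ * w / (1 + r ^ 2 * φ)) (φ * v / (1 + r ^ 2 * φ)).toNNReal b := by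
  have hc : 0 < 1 + r ^ 2 * φ := by positivity
  simp only [gaussianPDFReal]
  rw [Real.coe_toNNReal _ (by positivity), Real.coe_toNNReal _ hv.le,
    Real.coe_toNNReal _ (by positivity), Real.coe_toNNReal _ (by positivity)]
  rw [mul_mul_mul_comm,
    mul_mul_mul_comm (√(2 * Real.pi * ((1 + r ^ 2 * φ) * v)))⁻¹, ← Real.exp_add, ← Real.exp_add, ← mul_inv, ← mul_inv,
    ← Real.sqrt_mul (by positivity), ← Real.sqrt_mul (by positivity)]
  congr 1
  · congr 2
    field_simp
  · congr 1
    field_simp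
    ring

theorem integral_gaussianPDFReal_gaussianReal {r φ v : ℝ} (hφ : 0 < φ) (hv : 0 < v) (w : ℝ) :
    ∫ b, gaussianPDFReal (r * b) v.toNNReal w ∂(gaussianReal 0 (φ * v).toNNReal) =
      gaussianPDFReal 0 ((1 + r ^ 2 * φ) * v).toNNReal w := by
  have hne : (φ * v).toNNReal ≠ 0 := by
    rw [Ne, Real.toNNReal_eq_zero, not_le]; positivity
  have hne' : (φ * v / (1 + r ^ 2 * φ)).toNNReal ≠ 0 := by
    rw [Ne, Real.toNNReal_eq_zero, not_le]; positivity
  rw [integral_gaussianReal_eq_integral_smul hne]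
  simp only [smul_eq_mul, gaussianPDFReal_mul_gaussianPDFReal hφ hv]
  rw [integral_const_mul, integral_gaussianPDFReal_eq_one _ hne', mul_one]

theorem gaussianPDFReal_inv_var {c t : ℝ} (hc : 0 < c) (ht : 0 < t) (w : ℝ) :
    gaussianPDFReal 0 (c * t⁻¹).toNNReal w =
      (√(2 * Real.pi))⁻¹ * √t * ((√c)⁻¹ * Real.exp (-(t / 2) * (w ^ 2 / c))) := by
  simp only [gaussianPDFReal]
  rw [Real.coe_toNNReal _ (by positivity), Real.sqrt_mul (by positivity),
    Real.sqrt_mul hc.le, Real.sqrt_inv]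
  have : -(w - 0) ^ 2 / (2 * (c * t⁻¹)) = -(t / 2) * (w ^ 2 / c) := by
    field_simp
    ring
  rw [this]
  simp only [mul_inv, inv_inv]
  ring

theorem integral_likelihood_coefPrior {n : ℕ} (hn : 1 ≤ n) {X : Matrix (Fin n) (Fin n) ℝ}
    (hX : Xᵀ * X = (n : ℝ) • (1 : Matrix (Fin n) (Fin n) ℝ)) {φ t : ℝ} (hφ : 0 < φ) (ht : 0 < t)
    (y : Fin n → ℝ) (γ : Finset (Fin n)) :
    ∫ β, likelihood X β t⁻¹ y ∂(coefPrior (fun _ => φ) γ t⁻¹) =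
      ((√(2 * Real.pi))⁻¹ * √t) ^ n * ((√(1 + n * φ))⁻¹ ^ γ.card *
        Real.exp (-(t / 2) * (dispersion (n * φ) (score X y) γ - 1))) := by
  have ht' : 0 < t⁻¹ := inv_pos.2 ht
  have hfac : ∀ j, ∫ b, gaussianPDFReal (√(n : ℝ) * b) (t⁻¹).toNNReal (score X y j)
      ∂(if j ∈ γ then gaussianReal 0 (φ * t⁻¹).toNNReal else Measure.dirac 0) =
      (√(2 * Real.pi))⁻¹ * √t * ((if j ∈ γ then (√(1 + n * φ))⁻¹ else 1) *
        Real.exp (-(t / 2) * (score X y j ^ 2 / (if j ∈ γ then 1 + n * φ else 1)))) := by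
    intro j
    split_ifs with hj
    · rw [integral_gaussianPDFReal_gaussianReal hφ ht', Real.sq_sqrt (Nat.cast_nonneg n),
        gaussianPDFReal_inv_var (by positivity) ht]
    · rw [integral_dirac, mul_zero]
      have := gaussianPDFReal_inv_var one_pos ht (score X y j)
      simpa using this
  simp only [likelihood_eq_prod hn hX, coefPrior]
  have : ∀ j, SigmaFinite (if j ∈ γ then gaussianReal 0 (φ * t⁻¹).toNNReal
      else Measure.dirac (0 : ℝ)) := fun j => by split_ifs <;> infer_instance
  rw [integral_fintype_prod_eq_prod
    (f := fun j b => gaussianPDFReal (√(n : ℝ) * b) (t⁻¹).toNNReal (score X y j))]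
  simp only [hfac, Finset.prod_mul_distrib, Finset.prod_const, Finset.card_univ,
    Fintype.card_fin, Finset.prod_ite, ← Real.exp_sum, ← Finset.mul_sum, one_pow, mul_one,
    dispersion, add_sub_cancel_left, mul_pow]
  simp

theorem integral_gammaMeasure {a r : ℝ} (ha : 0 < a) (hr : 0 < r) (f : ℝ → ℝ) :
    ∫ t, f t ∂(gammaMeasure a r) =
      ∫ t in Set.Ioi 0, r ^ a / Real.Gamma a * t ^ (a - 1) * Real.exp (-(r * t)) * f t := by
  have hm : Measurable (gammaPDF a r) := (measurable_gammaPDFReal a r).ennreal_ofReal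
  rw [gammaMeasure, integral_withDensity_eq_integral_toReal_smul hm (by simp [gammaPDF])]
  rw [← integral_indicator measurableSet_Ioi]
  apply integral_congr_ae
  have h0 : ∀ᵐ t : ℝ, t ≠ 0 := by simp [ae_iff]
  filter_upwards [h0] with t ht
  rw [gammaPDF, ENNReal.toReal_ofReal (gammaPDFReal_nonneg ha hr t), smul_eq_mul, gammaPDFReal]
  rcases lt_or_gt_of_ne ht with h | h
  · simp [Set.indicator, not_lt.2 h.le, not_le.2 h]
  · simp [Set.indicator, h, h.le]

theorem dispersion_ge_one {n : ℕ} {a : ℝ} (ha : 0 < a) (w : Fin n → ℝ) (γ : Finset (Fin n)) :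
    1 ≤ dispersion a w γ := by
  rw [dispersion, le_add_iff_nonneg_right]
  refine Finset.sum_nonneg fun j _ => ?_
  split_ifs <;> positivity

/-- Conjugacy in the precision `t`: the likelihood contributes `t^(n/2) exp(-t(D-1)/2)`, and the
rate `1/2` of the chi-squared prior supplies the missing 1 in `D`. The Gamma integral then gives
`D^(-(n+ν)/2)` and factors free of `γ`. -/
theorem marginalLikelihood_eq {n : ℕ} (hn : 1 ≤ n) {X : Matrix (Fin n) (Fin n) ℝ}
    (hX : Xᵀ * X = (n : ℝ) • (1 : Matrix (Fin n) (Fin n) ℝ)) {ν φ : ℝ} (hν : 0 < ν) (hφ : 0 < φ)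
    (y : Fin n → ℝ) :
    ∃ C : ℝ, 0 < C ∧ ∀ γ, marginalLikelihood ν (fun _ => φ) X y γ =
      C * modelWeight ((n + ν) / 2) (n * φ) (score X y) γ := by
  refine ⟨(1 / 2) ^ (ν / 2) / Real.Gamma (ν / 2) * (√(2 * Real.pi))⁻¹ ^ n *
    ((1 / 2) ^ (-((n + ν) / 2)) * Real.Gamma ((n + ν) / 2)), ?_, fun γ => ?_⟩
  · have := Real.Gamma_pos_of_pos (s := ν / 2) (by positivity)
    have := Real.Gamma_pos_of_pos (s := (n + ν) / 2) (by positivity)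
    positivity
  set D := dispersion (n * φ) (score X y) γ with hD
  have hD1 : 1 ≤ D := dispersion_ge_one (by positivity) _ _
  rw [marginalLikelihood, chiSquared, integral_gammaMeasure (by positivity) (by positivity)]
  have hint : ∀ t ∈ Set.Ioi (0 : ℝ), (1 / 2) ^ (ν / 2) / Real.Gamma (ν / 2) * t ^ (ν / 2 - 1) *
      Real.exp (-(1 / 2 * t)) * ∫ β, likelihood X β t⁻¹ y ∂(coefPrior (fun _ => φ) γ t⁻¹) =
      ((1 / 2) ^ (ν / 2) / Real.Gamma (ν / 2) * (√(2 * Real.pi))⁻¹ ^ n *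
        (√(1 + n * φ))⁻¹ ^ γ.card) *
        (t ^ ((n + ν) / 2 - 1) * Real.exp (-(D / 2 * t))) := by
    intro t ht
    have ht : 0 < t := ht
    rw [integral_likelihood_coefPrior hn hX hφ ht, ← hD]
    have h1 : t ^ ((n + ν) / 2 - 1) = t ^ (ν / 2 - 1) * √t ^ n := by
      rw [Real.sqrt_eq_rpow, ← Real.rpow_natCast, ← Real.rpow_mul ht.le, ← Real.rpow_add ht]
      congr 1; ring
    have h2 : Real.exp (-(D / 2 * t)) =
        Real.exp (-(1 / 2 * t)) * Real.exp (-(t / 2) * (D - 1)) := by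
      rw [← Real.exp_add]
      congr 1; ring
    rw [h1, h2, mul_pow]
    ring
  rw [setIntegral_congr_fun measurableSet_Ioi hint, integral_const_mul,
    Real.integral_rpow_mul_exp_neg_mul_Ioi (by positivity) (by positivity), modelWeight, ← hD]
  have h3 : (1 / (D / 2)) ^ ((n + ν) / 2) = (1 / 2) ^ (-((n + ν) / 2)) * D ^ (-((n + ν) / 2)) := by
    rw [← Real.mul_rpow (by positivity) (by positivity), Real.rpow_neg (by positivity),
      ← Real.inv_rpow (by positivity)]
    congr 1
    field_simp
  rw [h3]
  ring

theorem modelWeight_pos {n : ℕ} {a : ℝ} (ha : 0 < a) (q : ℝ) (w : Fin n → ℝ)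
    (γ : Finset (Fin n)) : 0 < modelWeight q a w γ := by
  have h := dispersion_ge_one ha w γ
  unfold modelWeight
  positivity

theorem posteriorProb_eq {n : ℕ} (hn : 1 ≤ n) {X : Matrix (Fin n) (Fin n) ℝ}
    (hX : Xᵀ * X = (n : ℝ) • (1 : Matrix (Fin n) (Fin n) ℝ)) {ν φ : ℝ} (hν : 0 < ν) (hφ : 0 < φ)
    (y : Fin n → ℝ) (γ : Finset (Fin n)) :
    posteriorProb ν (fun _ => φ) (flatPrior n) X y γ =
      modelWeight ((n + ν) / 2) (n * φ) (score X y) γ /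
        ∑ γ', modelWeight ((n + ν) / 2) (n * φ) (score X y) γ' := by
  obtain ⟨C, hC, h⟩ := marginalLikelihood_eq hn hX hν hφ y
  have h2 : ((2 : ℝ) ^ n)⁻¹ * C ≠ 0 := by positivity
  simp only [posteriorProb, flatPrior, h, ← mul_assoc, ← Finset.mul_sum]
  rw [mul_div_mul_left _ _ h2]

theorem posteriorOdds_eq {n : ℕ} (hn : 1 ≤ n) {X : Matrix (Fin n) (Fin n) ℝ}
    (hX : Xᵀ * X = (n : ℝ) • (1 : Matrix (Fin n) (Fin n) ℝ)) {ν φ : ℝ} (hν : 0 < ν) (hφ : 0 < φ)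
    (y : Fin n → ℝ) (γ₀ γ : Finset (Fin n)) :
    posteriorOdds ν (fun _ => φ) (flatPrior n) X y γ₀ γ =
      modelWeight ((n + ν) / 2) (n * φ) (score X y) γ /
        modelWeight ((n + ν) / 2) (n * φ) (score X y) γ₀ := by
  have ha : 0 < n * φ := by positivity
  have hpos := Finset.sum_pos (fun γ' (_ : γ' ∈ (Finset.univ : Finset (Finset (Fin n)))) =>
    modelWeight_pos ha ((n + ν) / 2) (score X y) γ') Finset.univ_nonempty
  rw [posteriorOdds, posteriorProb_eq hn hX hν hφ, posteriorProb_eq hn hX hν hφ,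
    div_div_div_cancel_right₀ hpos.ne']

/-! ### Uniform control of the noise scores -/

theorem lintegral_exp_sum_gaussian {n : ℕ} (v : NNReal) (u : Fin n → ℝ) :
    ∫⁻ e, ENNReal.ofReal (Real.exp (∑ i, u i * e i)) ∂(Measure.pi fun _ => gaussianReal 0 v) =
      ENNReal.ofReal (Real.exp (v * (∑ i, u i ^ 2) / 2)) := by
  have hint : Integrable (fun e : Fin n → ℝ => ∏ i, Real.exp (u i * e i))
      (Measure.pi fun _ => gaussianReal 0 v) :=
    Integrable.fintype_prod (f := fun i x => Real.exp (u i * x))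
      fun i => integrable_exp_mul_gaussianReal (u i)
  have hone : ∀ i, ∫ x, Real.exp (u i * x) ∂(gaussianReal 0 v) =
      Real.exp (v * u i ^ 2 / 2) := by
    intro i
    have := congrFun (mgf_fun_id_gaussianReal (μ := 0) (v := v)) (u i)
    simpa [mgf] using this
  simp only [Real.exp_sum]
  rw [← ofReal_integral_eq_lintegral_ofReal hint (ae_of_all _ fun e => by positivity),
    integral_fintype_prod_eq_prod (f := fun i x => Real.exp (u i * x))]
  simp only [hone, ← Real.exp_sum, Finset.mul_sum, Finset.sum_div]

section Noise

variable {Ω : Type*} [MeasurableSpace Ω] {P : Measure Ω} [IsProbabilityMeasure P] {n : ℕ}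
  {X : Ω → Matrix (Fin n) (Fin n) ℝ} {ε : Ω → Fin n → ℝ} {v : NNReal}

/-- By independence the design can be frozen. Its columns have squared norm `n`, so the Gaussian
moment generating function of the score does not depend on the frozen value. -/
theorem lintegral_exp_score (hn : 1 ≤ n) (hXmeas : ∀ i j, Measurable fun ω => X ω i j)
    (hX : ∀ᵐ ω ∂P, (X ω)ᵀ * X ω = (n : ℝ) • (1 : Matrix (Fin n) (Fin n) ℝ))
    (hε : HasLaw ε (Measure.pi fun _ => gaussianReal 0 v) P)
    (hindep : IndepFun (fun ω (i j : Fin n) => X ω i j) ε P) (l : ℝ) (j : Fin n) :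
    ∫⁻ ω, ENNReal.ofReal (Real.exp (l * score (X ω) (ε ω) j)) ∂P =
      ENNReal.ofReal (Real.exp (v * l ^ 2 / 2)) := by
  have hn' : (n : ℝ) ≠ 0 := by positivity
  have hXm : Measurable fun ω (i j : Fin n) => X ω i j :=
    measurable_pi_lambda _ fun i => measurable_pi_lambda _ fun j => hXmeas i j
  let g : (Fin n → Fin n → ℝ) × (Fin n → ℝ) → ENNReal := fun z =>
    ENNReal.ofReal (Real.exp (∑ i, (l * (√(n : ℝ))⁻¹ * z.1 i j) * z.2 i))
  have hg : Measurable g := by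
    refine ENNReal.measurable_ofReal.comp (Real.measurable_exp.comp ?_)
    refine Finset.measurable_sum _ fun i _ => ?_
    have h1 : Measurable fun z : (Fin n → Fin n → ℝ) × (Fin n → ℝ) => z.1 i j :=
      (measurable_pi_apply j).comp ((measurable_pi_apply i).comp measurable_fst)
    have h2 : Measurable fun z : (Fin n → Fin n → ℝ) × (Fin n → ℝ) => z.2 i :=
      (measurable_pi_apply i).comp measurable_snd
    exact (h1.const_mul _).mul h2
  have hval : ∀ ω, ENNReal.ofReal (Real.exp (l * score (X ω) (ε ω) j)) =
      g (fun i j => X ω i j, ε ω) := by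
    intro ω
    simp only [g, score, Matrix.mulVec, dotProduct, Matrix.transpose_apply, Finset.mul_sum]
    congr 2
    exact Finset.sum_congr rfl fun i _ => by ring
  have hpair := (indepFun_iff_map_prod_eq_prod_map_map hXm.aemeasurable hε.aemeasurable).1 hindep
  simp only [hval]
  rw [← lintegral_map' (f := g) (g := fun ω => (fun i j => X ω i j, ε ω)) hg.aemeasurable
    (hXm.aemeasurable.prodMk hε.aemeasurable), hpair, hε.map_eq,
    lintegral_prod _ hg.aemeasurable, lintegral_map hg.lintegral_prod_right' hXm]
  have hae : ∀ᵐ ω ∂P, ∫⁻ e, g (fun i j => X ω i j, e)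
      ∂(Measure.pi fun _ : Fin n => gaussianReal 0 v) =
      ENNReal.ofReal (Real.exp (v * l ^ 2 / 2)) := by
    filter_upwards [hX] with ω hω
    simp only [g]
    rw [lintegral_exp_sum_gaussian]
    congr 3
    have hcol : ∑ i, X ω i j ^ 2 = n := by
      have := congrFun (congrFun hω j) j
      simpa [Matrix.mul_apply, sq] using this
    have : ∑ i, (l * (√(n : ℝ))⁻¹ * X ω i j) ^ 2 = l ^ 2 := by
      simp only [mul_pow, ← Finset.mul_sum, hcol, inv_pow, Real.sq_sqrt (Nat.cast_nonneg n)]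
      field_simp
    rw [this]
  rw [lintegral_congr_ae hae, lintegral_const, measure_univ, mul_one]

/-- Chernoff bound. The values `l = 2` and `l = -2` cover the two tails, and the resulting `n^(-2)`
leaves `n^(-1)` after a union over `n` coordinates. -/
theorem measure_score_gt_le (hn : 1 ≤ n) (hXmeas : ∀ i j, Measurable fun ω => X ω i j)
    (hX : ∀ᵐ ω ∂P, (X ω)ᵀ * X ω = (n : ℝ) • (1 : Matrix (Fin n) (Fin n) ℝ))
    (hε : HasLaw ε (Measure.pi fun _ => gaussianReal 0 v) P)
    (hindep : IndepFun (fun ω (i j : Fin n) => X ω i j) ε P) {l : ℝ} (hl : |l| = 2) (j : Fin n) :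
    P {ω | 2 * Real.log n ≤ l * score (X ω) (ε ω) j} ≤
      ENNReal.ofReal (Real.exp (2 * v) / n ^ 2) := by
  have hn' : (0 : ℝ) < n := by positivity
  have hscore : AEMeasurable (fun ω => score (X ω) (ε ω) j) P := by
    simp only [score, Matrix.mulVec, dotProduct, Matrix.transpose_apply]
    refine AEMeasurable.const_mul (Finset.aemeasurable_fun_sum _ fun i _ => ?_) _
    exact (hXmeas i j).aemeasurable.mul ((measurable_pi_apply i).comp_aemeasurable hε.aemeasurable)
  have hmeas : AEMeasurable
      (fun ω => ENNReal.ofReal (Real.exp (l * score (X ω) (ε ω) j))) P :=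
    ENNReal.measurable_ofReal.comp_aemeasurable
      (Real.measurable_exp.comp_aemeasurable (hscore.const_mul l))
  have hmark := mul_meas_ge_le_lintegral₀ hmeas (ENNReal.ofReal ((n : ℝ) ^ 2))
  rw [lintegral_exp_score hn hXmeas hX hε hindep] at hmark
  have hset : {ω | 2 * Real.log n ≤ l * score (X ω) (ε ω) j} ⊆
      {ω | ENNReal.ofReal ((n : ℝ) ^ 2) ≤
        ENNReal.ofReal (Real.exp (l * score (X ω) (ε ω) j))} := by
    intro ω hω
    refine ENNReal.ofReal_le_ofReal ?_
    have h := Real.exp_le_exp.2 (show 2 * Real.log n ≤ l * score (X ω) (ε ω) j from hω)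
    rwa [two_mul, Real.exp_add, Real.exp_log hn', ← sq] at h
  refine (measure_mono hset).trans ?_
  have hsq : l ^ 2 = 4 := by rw [← sq_abs, hl]; norm_num
  rw [hsq, show (v : ℝ) * 4 / 2 = 2 * v by ring] at hmark
  rw [ENNReal.ofReal_div_of_pos (by positivity), ENNReal.le_div_iff_mul_le
    (Or.inl (ENNReal.ofReal_pos.2 (by positivity)).ne') (Or.inl ENNReal.ofReal_ne_top), mul_comm]
  exact hmark

theorem measure_exists_score_gt_le (hn : 1 ≤ n) (hXmeas : ∀ i j, Measurable fun ω => X ω i j)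
    (hX : ∀ᵐ ω ∂P, (X ω)ᵀ * X ω = (n : ℝ) • (1 : Matrix (Fin n) (Fin n) ℝ))
    (hε : HasLaw ε (Measure.pi fun _ => gaussianReal 0 v) P)
    (hindep : IndepFun (fun ω (i j : Fin n) => X ω i j) ε P) :
    P {ω | ¬ ∀ j, |score (X ω) (ε ω) j| ≤ Real.log n} ≤
      ENNReal.ofReal (2 * Real.exp (2 * v) / n) := by
  have hsub : {ω | ¬ ∀ j, |score (X ω) (ε ω) j| ≤ Real.log n} ⊆
      ⋃ j, ({ω | 2 * Real.log n ≤ 2 * score (X ω) (ε ω) j} ∪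
        {ω | 2 * Real.log n ≤ -2 * score (X ω) (ε ω) j}) := by
    intro ω hω
    simp only [Set.mem_ofPred_eq, not_forall, not_le, lt_abs] at hω
    obtain ⟨j, hj⟩ := hω
    refine Set.mem_iUnion.2 ⟨j, hj.imp (fun h => ?_) fun h => ?_⟩ <;>
      simp only [Set.mem_ofPred_eq] <;> linarith
  refine (measure_mono hsub).trans ((measure_iUnion_fintype_le _ _).trans ?_)
  calc _ ≤ ∑ _j : Fin n, ENNReal.ofReal (2 * (Real.exp (2 * v) / n ^ 2)) := by
        refine Finset.sum_le_sum fun j _ => (measure_union_le _ _).trans ?_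
        rw [two_mul (Real.exp (2 * v) / n ^ 2), ENNReal.ofReal_add (by positivity) (by positivity)]
        exact add_le_add (measure_score_gt_le hn hXmeas hX hε hindep (by norm_num) j)
          (measure_score_gt_le hn hXmeas hX hε hindep (by norm_num) j)
    _ = _ := by
        rw [Finset.sum_const, Finset.card_univ, Fintype.card_fin, nsmul_eq_mul,
          ← ENNReal.ofReal_natCast, ← ENNReal.ofReal_mul (by positivity)]
        congr 1
        field_simp

end Noise

/-! ### Deterministic comparison of model weights -/

section Weights

variable {n : ℕ} {a q : ℝ} {w : Fin n → ℝ} {γ₀ γ : Finset (Fin n)}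

theorem dispersion_anti (ha : 0 < a) (w : Fin n → ℝ) (h : γ₀ ⊆ γ) :
    dispersion a w γ ≤ dispersion a w γ₀ := by
  unfold dispersion
  gcongr with j
  split_ifs with h1 h2 h2
  · exact le_rfl
  · exact (h2 (h h1)).elim
  · linarith
  · exact le_rfl

theorem modelWeight_insert_ge (ha : 0 < a) (hq : 0 ≤ q) (w : Fin n → ℝ) {j : Fin n}
    (hj : j ∉ γ₀) :
    (√(1 + a))⁻¹ * modelWeight q a w γ₀ ≤ modelWeight q a w (insert j γ₀) := by
  have h1 := dispersion_ge_one ha w (insert j γ₀)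
  have h2 := dispersion_anti ha w (Finset.subset_insert j γ₀)
  rw [modelWeight, modelWeight, Finset.card_insert_of_notMem hj, pow_succ', ← mul_assoc]
  exact mul_le_mul_of_nonneg_left
    (Real.rpow_le_rpow_of_nonpos (by linarith) h2 (by linarith)) (by positivity)

/-- Only `γ₀` and its one-index enlargements are kept in the sum. No property of `w` enters, so the
resulting bound on the posterior needs no probabilistic estimate. -/
theorem modelWeight_mul_le_sum (ha : 0 < a) (hq : 0 ≤ q) (w : Fin n → ℝ)
    (γ₀ : Finset (Fin n)) :
    (1 + (n - γ₀.card) / √(1 + a)) * modelWeight q a w γ₀ ≤ ∑ γ, modelWeight q a w γ := by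
  have hinj : Set.InjOn (fun j => insert j γ₀) ((γ₀ᶜ : Finset (Fin n)) : Set (Fin n)) := by
    intro i hi j hj hij
    have hi' : i ∉ γ₀ := by simpa using hi
    have : i ∈ insert j γ₀ := by
      have h : insert i γ₀ = insert j γ₀ := hij
      rw [← h]; exact Finset.mem_insert_self i γ₀
    exact (Finset.mem_insert.1 this).resolve_right hi'
  have hnot : γ₀ ∉ γ₀ᶜ.image (fun j => insert j γ₀) := by
    intro h
    obtain ⟨j, hj, hj'⟩ := Finset.mem_image.1 h
    exact Finset.mem_compl.1 hj (hj' ▸ Finset.mem_insert_self j γ₀)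
  have hcard : ((γ₀ᶜ.card : ℕ) : ℝ) = n - γ₀.card := by
    rw [Finset.card_compl, Fintype.card_fin, Nat.cast_sub]
    simpa using Finset.card_le_univ γ₀
  calc (1 + (n - γ₀.card) / √(1 + a)) * modelWeight q a w γ₀
      = modelWeight q a w γ₀ + ∑ _j ∈ γ₀ᶜ, (√(1 + a))⁻¹ * modelWeight q a w γ₀ := by
        rw [Finset.sum_const, nsmul_eq_mul, hcard]
        ring
    _ ≤ modelWeight q a w γ₀ + ∑ j ∈ γ₀ᶜ, modelWeight q a w (insert j γ₀) := by
        gcongr with j hj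
        exact modelWeight_insert_ge ha hq w (Finset.mem_compl.1 hj)
    _ = ∑ γ ∈ insert γ₀ (γ₀ᶜ.image fun j => insert j γ₀), modelWeight q a w γ := by
        rw [Finset.sum_insert hnot, Finset.sum_image hinj]
    _ ≤ _ := Finset.sum_le_sum_of_subset_of_nonneg (Finset.subset_univ _)
        fun γ _ _ => (modelWeight_pos ha q w γ).le

theorem dispersion_le_add_card (ha : 0 < a) {L : ℝ} (hL : ∀ j ∉ γ₀, w j ^ 2 ≤ L ^ 2)
    (h : γ₀ ⊆ γ) : dispersion a w γ₀ ≤ dispersion a w γ + (γ \ γ₀).card * L ^ 2 := by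
  have hsum : ((γ \ γ₀).card : ℝ) * L ^ 2 = ∑ j, if j ∈ γ \ γ₀ then L ^ 2 else 0 := by
    rw [Finset.sum_ite_mem, Finset.univ_inter, Finset.sum_const, nsmul_eq_mul]
  rw [hsum, dispersion, dispersion, add_assoc, ← Finset.sum_add_distrib]
  gcongr with j
  by_cases h1 : j ∈ γ₀
  · simp [h1, h h1]
  · by_cases h2 : j ∈ γ
    · have h3 := hL j h1
      have h4 : 0 ≤ w j ^ 2 / (1 + a) := by positivity
      simp only [h1, h2, if_true, if_false, Finset.mem_sdiff, not_false_eq_true, and_self, div_one]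
      linarith
    · simp [h1, h2]

theorem sq_le_dispersion_of_notMem (ha : 0 < a) {j : Fin n} (hj : j ∉ γ) :
    w j ^ 2 ≤ dispersion a w γ := by
  have h := Finset.single_le_sum (f := fun j => w j ^ 2 / (if j ∈ γ then 1 + a else 1))
    (fun i _ => by split_ifs <;> positivity) (Finset.mem_univ j)
  simp only [hj, if_false, div_one] at h
  rw [dispersion]
  linarith

theorem sq_div_le_dispersion (ha : 0 < a) (j : Fin n) :
    w j ^ 2 / (1 + a) ≤ dispersion a w γ := by
  have h := Finset.single_le_sum (f := fun j => w j ^ 2 / (if j ∈ γ then 1 + a else 1))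
    (fun i _ => by split_ifs <;> positivity) (Finset.mem_univ j)
  have h2 : w j ^ 2 / (1 + a) ≤ w j ^ 2 / (if j ∈ γ then 1 + a else 1) := by
    split_ifs
    · exact le_rfl
    · gcongr
      linarith
  rw [dispersion]
  linarith

theorem dispersion_le (ha : 0 < a) {L : ℝ} (hL : ∀ j ∉ γ, w j ^ 2 ≤ L ^ 2) :
    dispersion a w γ ≤ 1 + n * L ^ 2 + (∑ j ∈ γ, w j ^ 2) / (1 + a) := by
  have hsum : (∑ j ∈ γ, w j ^ 2) / (1 + a) = ∑ j, if j ∈ γ then w j ^ 2 / (1 + a) else 0 := by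
    rw [Finset.sum_div]
    simp
  have hn : (n : ℝ) * L ^ 2 = ∑ _j : Fin n, L ^ 2 := by simp
  rw [hsum, hn, dispersion, add_assoc, ← Finset.sum_add_distrib]
  gcongr with j
  by_cases h1 : j ∈ γ
  · simp only [h1, if_true, le_add_iff_nonneg_left]
    positivity
  · simp [h1, hL j h1]

/-- Removing the `k` extra indices raises the dispersion by at most `k L²`, whereas a single
shrunken signal already makes it at least `A/(1+a)`. The relative increase is at most `kx` with `x =
L²(1+a)/A`; replacing `1 + kx` by `exp(kx)` makes the bound a `k`-th power. -/
theorem modelWeight_le_of_subset (ha : 0 < a) (hq : 0 ≤ q) {L A : ℝ} (hA0 : 0 < A)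
    (hne : γ₀.Nonempty) (hA : ∀ j ∈ γ₀, A ≤ w j ^ 2) (hL : ∀ j ∉ γ₀, w j ^ 2 ≤ L ^ 2)
    (h : γ₀ ⊆ γ) :
    modelWeight q a w γ ≤
      ((√(1 + a))⁻¹ * Real.exp (q * (L ^ 2 * (1 + a) / A))) ^ (γ \ γ₀).card *
        modelWeight q a w γ₀ := by
  obtain ⟨i, hi⟩ := hne
  set k := (γ \ γ₀).card with hk
  set D := dispersion a w γ with hD
  set D₀ := dispersion a w γ₀ with hD₀
  have hD1 : 1 ≤ D := dispersion_ge_one ha w γ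
  have hD₀1 : 1 ≤ D₀ := dispersion_ge_one ha w γ₀
  have hDA : A / (1 + a) ≤ D := (by gcongr; exact hA i hi : A / (1 + a) ≤ w i ^ 2 / (1 + a)).trans
    (sq_div_le_dispersion ha i)
  have hadd : D₀ ≤ D + k * L ^ 2 := dispersion_le_add_card ha hL h
  have hx : L ^ 2 ≤ D * (L ^ 2 * (1 + a) / A) := by
    calc L ^ 2 = A / (1 + a) * (L ^ 2 * (1 + a) / A) := by field_simp
      _ ≤ _ := by gcongr
  have hexp : D₀ ≤ D * Real.exp (k * (L ^ 2 * (1 + a) / A)) := by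
    have h1 := Real.add_one_le_exp (k * (L ^ 2 * (1 + a) / A))
    have h2 : (k : ℝ) * L ^ 2 ≤ k * (D * (L ^ 2 * (1 + a) / A)) := by gcongr
    nlinarith
  have hpow : D ^ (-q) ≤ Real.exp (q * (L ^ 2 * (1 + a) / A)) ^ k * D₀ ^ (-q) := by
    have h1 := Real.rpow_le_rpow_of_nonpos (by linarith) hexp (neg_nonpos.2 hq)
    rw [Real.mul_rpow (by linarith) (Real.exp_pos _).le, ← Real.exp_mul] at h1
    calc D ^ (-q) = Real.exp (q * (L ^ 2 * (1 + a) / A)) ^ k *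
          (D ^ (-q) * Real.exp (k * (L ^ 2 * (1 + a) / A) * -q)) := by
          rw [← Real.exp_nat_mul, mul_left_comm, ← Real.exp_add]
          ring_nf
          simp
      _ ≤ _ := by gcongr
  have hcard : γ.card = k + γ₀.card := by
    rw [hk, Finset.card_sdiff_add_card_eq_card h]
  rw [modelWeight, modelWeight, ← hD, ← hD₀, hcard, pow_add, mul_pow]
  calc _ ≤ (√(1 + a))⁻¹ ^ k * (√(1 + a))⁻¹ ^ γ₀.card *
        (Real.exp (q * (L ^ 2 * (1 + a) / A)) ^ k * D₀ ^ (-q)) := by gcongr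
    _ = _ := by ring

/-- A missed signal enters the dispersion unshrunk, so `D(γ) ≥ A ≥ D(γ₀)/ρ`. The size penalty of `γ`
is bounded by 1, which leaves the factor `√(1+a)^|γ₀|`. -/
theorem modelWeight_le_of_not_subset (ha : 0 < a) (hq : 0 ≤ q) {A ρ : ℝ} (hρ : 0 < ρ)
    (hA : ∀ j ∈ γ₀, A ≤ w j ^ 2) (hD : dispersion a w γ₀ ≤ ρ * A) (h : ¬ γ₀ ⊆ γ) :
    modelWeight q a w γ ≤ √(1 + a) ^ γ₀.card * ρ ^ q * modelWeight q a w γ₀ := by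
  obtain ⟨j, hj, hj'⟩ := Finset.not_subset.1 h
  have hle : A ≤ dispersion a w γ := (hA j hj).trans (sq_le_dispersion_of_notMem ha hj')
  have hD₀1 : 1 ≤ dispersion a w γ₀ := dispersion_ge_one ha w γ₀
  have hs1 : 1 ≤ √(1 + a) := Real.one_le_sqrt.2 (by linarith)
  have h1 : dispersion a w γ ^ (-q) ≤ ρ ^ q * dispersion a w γ₀ ^ (-q) := by
    have h2 : dispersion a w γ₀ / ρ ≤ dispersion a w γ := by
      rw [div_le_iff₀ hρ]
      nlinarith
    have h3 := Real.rpow_le_rpow_of_nonpos (by positivity) h2 (neg_nonpos.2 hq)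
    rwa [Real.div_rpow (by linarith) hρ.le, Real.rpow_neg hρ.le, div_inv_eq_mul, mul_comm] at h3
  have h4 : (√(1 + a))⁻¹ ^ γ.card ≤ 1 :=
    pow_le_one₀ (by positivity) (inv_le_one_of_one_le₀ hs1)
  have h5 : √(1 + a) ^ γ₀.card * (√(1 + a))⁻¹ ^ γ₀.card = 1 := by
    rw [← mul_pow, mul_inv_cancel₀ (by positivity), one_pow]
  have h6 := dispersion_ge_one ha w γ
  calc modelWeight q a w γ ≤ 1 * (ρ ^ q * dispersion a w γ₀ ^ (-q)) := by
        unfold modelWeight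
        gcongr
    _ = √(1 + a) ^ γ₀.card * (√(1 + a))⁻¹ ^ γ₀.card *
        (ρ ^ q * dispersion a w γ₀ ^ (-q)) := by rw [h5]
    _ = _ := by
        rw [modelWeight]
        ring

/-- Supersets of `γ₀` are determined by their excess over it. Summing over every possible excess
gives `(1+θ)^n` by the binomial theorem. -/
theorem sum_le_of_bounds {f : Finset (Fin n) → ℝ} {θ τ : ℝ} (hθ : 0 ≤ θ) (hτ : 0 ≤ τ)
    (h1 : ∀ γ, γ₀ ⊆ γ → f γ ≤ θ ^ (γ \ γ₀).card) (h2 : ∀ γ, ¬ γ₀ ⊆ γ → f γ ≤ τ) :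
    ∑ γ, f γ ≤ (1 + θ) ^ n + 2 ^ n * τ := by
  have hle : ∀ γ, f γ ≤ (if γ₀ ⊆ γ then θ ^ (γ \ γ₀).card else 0) + τ := by
    intro γ
    split_ifs with h
    · linarith [h1 γ h]
    · linarith [h2 γ h]
  have hinj : Set.InjOn (fun γ => γ \ γ₀)
      ((Finset.univ.filter fun γ => γ₀ ⊆ γ : Finset (Finset (Fin n))) : Set (Finset (Fin n))) := by
    intro γ hγ γ' hγ' he
    have hγ : γ₀ ⊆ γ := by simpa using hγ
    have hγ' : γ₀ ⊆ γ' := by simpa using hγ'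
    rw [← Finset.sdiff_union_of_subset hγ, ← Finset.sdiff_union_of_subset hγ']
    exact congrArg (· ∪ γ₀) he
  have hpow : ∑ T : Finset (Fin n), θ ^ T.card = (1 + θ) ^ n := by
    have := Fintype.sum_pow_mul_eq_add_pow (Fin n) θ (1 : ℝ)
    simpa [add_comm] using this
  refine (Finset.sum_le_sum fun γ _ => hle γ).trans ?_
  rw [Finset.sum_add_distrib, ← Finset.sum_filter]
  gcongr
  · rw [← Finset.sum_image (f := fun T : Finset (Fin n) => θ ^ T.card) hinj, ← hpow]
    exact Finset.sum_le_sum_of_subset_of_nonneg (Finset.subset_univ _) fun _ _ _ => by positivity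
  · simp

end Weights

/-! ### Bounds on the posterior valid for every response -/

section Posterior

variable {n : ℕ} {X : Matrix (Fin n) (Fin n) ℝ} {ν φ : ℝ} {y : Fin n → ℝ} {γ₀ : Finset (Fin n)}

theorem posteriorProb_nonneg (hn : 1 ≤ n)
    (hX : Xᵀ * X = (n : ℝ) • (1 : Matrix (Fin n) (Fin n) ℝ)) (hν : 0 < ν) (hφ : 0 < φ)
    (y : Fin n → ℝ) (γ : Finset (Fin n)) :
    0 ≤ posteriorProb ν (fun _ => φ) (flatPrior n) X y γ := by
  have ha : 0 < n * φ := by positivity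
  rw [posteriorProb_eq hn hX hν hφ]
  exact div_nonneg (modelWeight_pos ha _ _ _).le
    (Finset.sum_nonneg fun γ' _ => (modelWeight_pos ha _ _ _).le)

theorem posteriorProb_le_one (hn : 1 ≤ n)
    (hX : Xᵀ * X = (n : ℝ) • (1 : Matrix (Fin n) (Fin n) ℝ)) (hν : 0 < ν) (hφ : 0 < φ)
    (y : Fin n → ℝ) (γ : Finset (Fin n)) :
    posteriorProb ν (fun _ => φ) (flatPrior n) X y γ ≤ 1 := by
  have ha : 0 < n * φ := by positivity
  rw [posteriorProb_eq hn hX hν hφ]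
  exact div_le_one_of_le₀ (Finset.single_le_sum
    (f := fun γ => modelWeight ((n + ν) / 2) (n * φ) (score X y) γ)
    (fun γ' _ => (modelWeight_pos ha _ _ _).le) (Finset.mem_univ γ))
    (Finset.sum_nonneg fun γ' _ => (modelWeight_pos ha _ _ _).le)

theorem posteriorProb_le (hn : 1 ≤ n)
    (hX : Xᵀ * X = (n : ℝ) • (1 : Matrix (Fin n) (Fin n) ℝ)) (hν : 0 < ν) (hφ : 0 < φ)
    (y : Fin n → ℝ) (γ₀ : Finset (Fin n)) :
    posteriorProb ν (fun _ => φ) (flatPrior n) X y γ₀ ≤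
      (1 + (n - γ₀.card) / √(1 + n * φ))⁻¹ := by
  have ha : 0 < n * φ := by positivity
  have hcard : (γ₀.card : ℝ) ≤ n := by
    have := Finset.card_le_univ γ₀
    rw [Fintype.card_fin] at this
    exact_mod_cast this
  have h := modelWeight_mul_le_sum ha (q := (n + ν) / 2) (by positivity) (score X y) γ₀
  have hW := modelWeight_pos ha ((n + ν) / 2) (score X y) γ₀
  have h0 : 0 ≤ (n - γ₀.card : ℝ) / √(1 + n * φ) := div_nonneg (by linarith) (Real.sqrt_nonneg _)
  have hS : 0 < ∑ γ, modelWeight ((n + ν) / 2) (n * φ) (score X y) γ :=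
    Finset.sum_pos (fun γ _ => modelWeight_pos ha _ _ γ) Finset.univ_nonempty
  rw [posteriorProb_eq hn hX hν hφ, div_le_iff₀ hS, ← div_eq_inv_mul, le_div_iff₀ (by positivity)]
  linarith

theorem inv_sqrt_le_maxPosteriorOdds (hn : 1 ≤ n)
    (hX : Xᵀ * X = (n : ℝ) • (1 : Matrix (Fin n) (Fin n) ℝ)) (hν : 0 < ν) (hφ : 0 < φ)
    (y : Fin n → ℝ) (hcard : γ₀.card < n) :
    (√(1 + n * φ))⁻¹ ≤ maxPosteriorOdds ν (fun _ => φ) (flatPrior n) X y γ₀ := by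
  have ha : 0 < n * φ := by positivity
  obtain ⟨j, hj⟩ : ∃ j, j ∉ γ₀ := by
    by_contra! h
    have := Finset.eq_univ_iff_forall.2 h
    simp [this] at hcard
  have hne : insert j γ₀ ≠ γ₀ := fun h => hj (h ▸ Finset.mem_insert_self j γ₀)
  refine le_trans ?_ (le_ciSup (f := fun γ : {γ : Finset (Fin n) // γ ≠ γ₀} =>
    posteriorOdds ν (fun _ => φ) (flatPrior n) X y γ₀ γ) (Set.finite_range _).bddAbove
    ⟨insert j γ₀, hne⟩)
  simp only [posteriorOdds_eq hn hX hν hφ]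
  rw [le_div_iff₀ (modelWeight_pos ha _ _ _)]
  exact modelWeight_insert_ge ha (by positivity) _ hj

theorem posteriorOdds_nonneg (hn : 1 ≤ n)
    (hX : Xᵀ * X = (n : ℝ) • (1 : Matrix (Fin n) (Fin n) ℝ)) (hν : 0 < ν) (hφ : 0 < φ)
    (y : Fin n → ℝ) (γ : Finset (Fin n)) :
    0 ≤ posteriorOdds ν (fun _ => φ) (flatPrior n) X y γ₀ γ :=
  div_nonneg (posteriorProb_nonneg hn hX hν hφ y γ) (posteriorProb_nonneg hn hX hν hφ y γ₀)

theorem posteriorProb_le_inv_posteriorOdds (hn : 1 ≤ n)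
    (hX : Xᵀ * X = (n : ℝ) • (1 : Matrix (Fin n) (Fin n) ℝ)) (hν : 0 < ν) (hφ : 0 < φ)
    (y : Fin n → ℝ) (γ : Finset (Fin n)) :
    posteriorProb ν (fun _ => φ) (flatPrior n) X y γ₀ ≤
      (posteriorOdds ν (fun _ => φ) (flatPrior n) X y γ₀ γ)⁻¹ := by
  have ha : 0 < n * φ := by positivity
  have hS : 0 < ∑ γ, modelWeight ((n + ν) / 2) (n * φ) (score X y) γ :=
    Finset.sum_pos (fun γ _ => modelWeight_pos ha _ _ γ) Finset.univ_nonempty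
  have h0 := posteriorProb_nonneg hn hX hν hφ y γ₀
  have h1 := posteriorProb_le_one hn hX hν hφ y γ
  have h2 : 0 < posteriorProb ν (fun _ => φ) (flatPrior n) X y γ := by
    rw [posteriorProb_eq hn hX hν hφ]
    exact div_pos (modelWeight_pos ha _ _ _) hS
  rw [posteriorOdds, inv_div]
  exact le_div_self h0 h2 h1

theorem posteriorProb_eq_inv_sum (hn : 1 ≤ n)
    (hX : Xᵀ * X = (n : ℝ) • (1 : Matrix (Fin n) (Fin n) ℝ)) (hν : 0 < ν) (hφ : 0 < φ)
    (y : Fin n → ℝ) (γ₀ : Finset (Fin n)) :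
    posteriorProb ν (fun _ => φ) (flatPrior n) X y γ₀ =
      (∑ γ, posteriorOdds ν (fun _ => φ) (flatPrior n) X y γ₀ γ)⁻¹ := by
  simp only [posteriorOdds_eq hn hX hν hφ, posteriorProb_eq hn hX hν hφ, ← Finset.sum_div, inv_div]

end Posterior

/-! ### Posterior odds when the noise scores are bounded -/

section Signal

variable {n : ℕ} {X : Matrix (Fin n) (Fin n) ℝ} {ν φ ψ C M L : ℝ} {β ε : Fin n → ℝ}

theorem score_response (hX : Xᵀ * X = (n : ℝ) • (1 : Matrix (Fin n) (Fin n) ℝ))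
    (β ε : Fin n → ℝ) (j : Fin n) :
    score X (X *ᵥ β + ε) j = √(n : ℝ) * β j + score X ε j := by
  rw [score_add, score_mulVec hX]

theorem sq_score_response_le (hX : Xᵀ * X = (n : ℝ) • (1 : Matrix (Fin n) (Fin n) ℝ))
    {j : Fin n} (hξ : |score X ε j| ≤ L) :
    score X (X *ᵥ β + ε) j ^ 2 ≤ 2 * n * β j ^ 2 + 2 * L ^ 2 := by
  rw [score_response hX]
  have h1 : score X ε j ^ 2 ≤ L ^ 2 := sq_le_sq' (abs_le.1 hξ).1 (abs_le.1 hξ).2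
  have h2 : (√(n : ℝ) * β j) ^ 2 = n * β j ^ 2 := by
    rw [mul_pow, Real.sq_sqrt (Nat.cast_nonneg n)]
  nlinarith [sq_nonneg (√(n : ℝ) * β j - score X ε j)]

theorem sum_sq_score_response_le (hX : Xᵀ * X = (n : ℝ) • (1 : Matrix (Fin n) (Fin n) ℝ))
    (hξ : ∀ j, |score X ε j| ≤ L) (hβ : ∑ j, β j ^ 2 ≤ C * ψ ^ 2) (γ : Finset (Fin n)) :
    ∑ j ∈ γ, score X (X *ᵥ β + ε) j ^ 2 ≤ 2 * n * (C * ψ ^ 2) + 2 * n * L ^ 2 := by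
  calc _ ≤ ∑ j, score X (X *ᵥ β + ε) j ^ 2 :=
        Finset.sum_le_sum_of_subset_of_nonneg (Finset.subset_univ _) fun _ _ _ => sq_nonneg _
    _ ≤ ∑ j, (2 * n * β j ^ 2 + 2 * L ^ 2) :=
        Finset.sum_le_sum fun j _ => sq_score_response_le hX (hξ j)
    _ = 2 * n * ∑ j, β j ^ 2 + 2 * n * L ^ 2 := by
        rw [Finset.sum_add_distrib, ← Finset.mul_sum]
        simp
        ring
    _ ≤ _ := by gcongr

theorem sq_score_response_ge (hX : Xᵀ * X = (n : ℝ) • (1 : Matrix (Fin n) (Fin n) ℝ))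
    {j : Fin n} (hξ : |score X ε j| ≤ L) (hψ : 0 ≤ ψ) (hj : ψ ≤ |β j|)
    (hL : 4 * L ^ 2 ≤ n * ψ ^ 2) :
    n * ψ ^ 2 / 4 ≤ score X (X *ᵥ β + ε) j ^ 2 := by
  rw [score_response hX]
  have hL0 : 0 ≤ L := (abs_nonneg _).trans hξ
  have hsq := Real.sq_sqrt (Nat.cast_nonneg (α := ℝ) n)
  have h1 : 2 * L ≤ √(n : ℝ) * ψ := by
    refine le_of_sq_le_sq ?_ (by positivity)
    rw [mul_pow, mul_pow, hsq]
    linarith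
  -- The noise is at most half of `√n ψ`, so at least half of the signal survives; squaring gives
  -- the factor `1/4`.
  have h2 : √(n : ℝ) * ψ ≤ |√(n : ℝ) * β j| := by
    rw [abs_mul, abs_of_nonneg (Real.sqrt_nonneg _)]
    gcongr
  have h3 : √(n : ℝ) * ψ / 2 ≤ |√(n : ℝ) * β j + score X ε j| := by
    have := abs_sub_abs_le_abs_sub (√(n : ℝ) * β j) (-score X ε j)
    rw [abs_neg, sub_neg_eq_add] at this
    linarith
  have h4 : (√(n : ℝ) * ψ / 2) ^ 2 ≤ |√(n : ℝ) * β j + score X ε j| ^ 2 := by gcongr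
  rw [sq_abs, div_pow, mul_pow, hsq] at h4
  linarith

/-- Both weight comparisons are used with `A = nψ²/4`. The assumption `L²(1+nφ) ≤ Mψ²` says that the
signal dominates the noise even after shrinkage. -/
theorem posteriorOdds_le (hn : 1 ≤ n)
    (hX : Xᵀ * X = (n : ℝ) • (1 : Matrix (Fin n) (Fin n) ℝ)) (hν : 0 < ν) (hφ : 0 < φ)
    (hC : 0 ≤ C) (hM : 0 < M) (hψ : 0 ≤ ψ) (hL1 : 1 ≤ L) (hξ : ∀ j, |score X ε j| ≤ L)
    (hβ : ∑ j, β j ^ 2 ≤ C * ψ ^ 2) (hmin : ∀ j ∈ stateVector β, ψ ≤ |β j|)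
    (hne : (stateVector β).Nonempty) (hLM : L ^ 2 * (1 + n * φ) ≤ M * ψ ^ 2) (hMn : 4 * M ≤ n)
    (γ : Finset (Fin n)) :
    (stateVector β ⊆ γ →
      posteriorOdds ν (fun _ => φ) (flatPrior n) X (X *ᵥ β + ε) (stateVector β) γ ≤
        ((√(1 + n * φ))⁻¹ * Real.exp (2 * M * (1 + ν))) ^ (γ \ stateVector β).card) ∧
    (¬ stateVector β ⊆ γ →
      posteriorOdds ν (fun _ => φ) (flatPrior n) X (X *ᵥ β + ε) (stateVector β) γ ≤
        √(1 + n * φ) ^ (stateVector β).card *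
          ((8 * C + 16 * M) / (1 + n * φ)) ^ ((n + ν) / 2)) := by
  have hn1 : (1 : ℝ) ≤ n := by exact_mod_cast hn
  have ha : 0 < n * φ := by positivity
  have hψ2 : 0 < ψ ^ 2 := by
    have : 0 < L ^ 2 * (1 + n * φ) := by positivity
    exact pos_of_mul_pos_right (this.trans_le hLM) hM.le
  have hLψ : L ^ 2 ≤ M * ψ ^ 2 := (le_mul_of_one_le_right (sq_nonneg L) (by linarith)).trans hLM
  have hA : ∀ j ∈ stateVector β, n * ψ ^ 2 / 4 ≤ score X (X *ᵥ β + ε) j ^ 2 := fun j hj =>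
    sq_score_response_ge hX (hξ j) hψ (hmin j hj) (by nlinarith)
  have hL : ∀ j ∉ stateVector β, score X (X *ᵥ β + ε) j ^ 2 ≤ L ^ 2 := by
    intro j hj
    have hj0 : β j = 0 := by simpa [stateVector] using hj
    rw [score_response hX, hj0, mul_zero, zero_add]
    exact sq_le_sq' (abs_le.1 (hξ j)).1 (abs_le.1 (hξ j)).2
  have hA0 : 0 < n * ψ ^ 2 / 4 := by positivity
  have hW := modelWeight_pos ha ((n + ν) / 2) (score X (X *ᵥ β + ε)) (stateVector β)
  rw [posteriorOdds_eq hn hX hν hφ, div_le_iff₀ hW, div_le_iff₀ hW]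
  constructor
  · intro h
    refine (modelWeight_le_of_subset ha (by positivity) hA0 hne hA hL h).trans ?_
    have hψ0 : ψ ≠ 0 := pow_ne_zero_iff (two_ne_zero) |>.1 hψ2.ne'
    -- The relative change of dispersion per index is at most `4M/n`, which offsets the exponent
    -- `(n+ν)/2`.
    have hexp : (n + ν) / 2 * (L ^ 2 * (1 + n * φ) / (n * ψ ^ 2 / 4)) ≤ 2 * M * (1 + ν) :=
      calc (n + ν) / 2 * (L ^ 2 * (1 + n * φ) / (n * ψ ^ 2 / 4))
          ≤ (n + ν) / 2 * (M * ψ ^ 2 / (n * ψ ^ 2 / 4)) := by gcongr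
        _ = 2 * M * ((n + ν) / n) := by field_simp; ring
        _ ≤ 2 * M * (1 + ν) := by
          gcongr
          rw [div_le_iff₀ (by positivity)]
          nlinarith
    have := Real.exp_le_exp.2 hexp
    gcongr
  · intro h
    refine modelWeight_le_of_not_subset ha (by positivity) (by positivity) hA ?_ h
    refine (dispersion_le ha hL).trans ?_
    have h1 : 1 ≤ n * L ^ 2 := by nlinarith
    have h2 : L ^ 2 ≤ M * ψ ^ 2 / (1 + n * φ) := by
      rwa [le_div_iff₀ (by positivity)]
    have h3 := sum_sq_score_response_le hX hξ hβ (stateVector β)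
    -- The sum is `nψ²(2C+4M)/(1+nφ)`; writing it as a multiple of `nψ²/4` produces `8C+16M`.
    calc 1 + n * L ^ 2 + (∑ j ∈ stateVector β, score X (X *ᵥ β + ε) j ^ 2) / (1 + n * φ)
        ≤ 2 * n * (M * ψ ^ 2 / (1 + n * φ)) +
          (2 * n * (C * ψ ^ 2) + 2 * n * (M * ψ ^ 2)) / (1 + n * φ) := by
          refine add_le_add (by nlinarith) ?_
          gcongr
          refine h3.trans ?_
          gcongr
      _ = _ := by ring

/-- The null model pays no size penalty. The true model pays at least one factor `(1+nφ)^(-1/2)`,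
and its dispersion term is at most 1. -/
theorem posteriorOdds_empty_ge (hn : 1 ≤ n)
    (hX : Xᵀ * X = (n : ℝ) • (1 : Matrix (Fin n) (Fin n) ℝ)) (hν : 0 < ν) (hφ : 0 < φ)
    (hξ : ∀ j, |score X ε j| ≤ L) (hβ : ∑ j, β j ^ 2 ≤ C * ψ ^ 2) (hne : (stateVector β).Nonempty)
    {R : ℝ} (hR : 1 + (2 * n * (C * ψ ^ 2) + 2 * n * L ^ 2) ≤ R) :
    √(1 + n * φ) * R ^ (-((n + ν) / 2)) ≤
      posteriorOdds ν (fun _ => φ) (flatPrior n) X (X *ᵥ β + ε) (stateVector β) ∅ := by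
  have ha : 0 < n * φ := by positivity
  have hW := modelWeight_pos ha ((n + ν) / 2) (score X (X *ᵥ β + ε)) (stateVector β)
  have hD₀ := dispersion_ge_one ha (score X (X *ᵥ β + ε)) (stateVector β)
  have hD := dispersion_ge_one ha (score X (X *ᵥ β + ε)) ∅
  have hDR : dispersion (n * φ) (score X (X *ᵥ β + ε)) ∅ ≤ R := by
    have := sum_sq_score_response_le hX hξ hβ Finset.univ
    simp only [dispersion, Finset.notMem_empty, if_false, div_one]
    linarith
  have hs1 : 1 ≤ √(1 + n * φ) := Real.one_le_sqrt.2 (by linarith)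
  have h1 : √(1 + n * φ) * (√(1 + n * φ))⁻¹ ^ (stateVector β).card ≤ 1 := by
    rw [inv_pow, ← div_eq_mul_inv, div_le_one (by positivity)]
    exact le_self_pow₀ hs1 hne.card_ne_zero
  have h2 : dispersion (n * φ) (score X (X *ᵥ β + ε)) (stateVector β) ^ (-((n + ν) / 2)) ≤ 1 :=
    Real.rpow_le_one_of_one_le_of_nonpos hD₀ (by linarith [show 0 ≤ (n + ν) / 2 by positivity])
  have h3 := Real.rpow_le_rpow_of_nonpos (by linarith) hDR
    (neg_nonpos.2 (show 0 ≤ (n + ν) / 2 by positivity))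
  have hR0 : 0 ≤ R ^ (-((n + ν) / 2)) := Real.rpow_nonneg (by linarith) _
  rw [posteriorOdds_eq hn hX hν hφ, le_div_iff₀ hW]
  calc √(1 + n * φ) * R ^ (-((n + ν) / 2)) *
        modelWeight ((n + ν) / 2) (n * φ) (score X (X *ᵥ β + ε)) (stateVector β)
      = √(1 + n * φ) * (√(1 + n * φ))⁻¹ ^ (stateVector β).card *
        dispersion (n * φ) (score X (X *ᵥ β + ε)) (stateVector β) ^ (-((n + ν) / 2)) *
        R ^ (-((n + ν) / 2)) := by
        rw [modelWeight]; ring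
    _ ≤ 1 * 1 * R ^ (-((n + ν) / 2)) := by gcongr
    _ ≤ modelWeight ((n + ν) / 2) (n * φ) (score X (X *ᵥ β + ε)) ∅ := by
        simpa [modelWeight] using h3

end Signal

/-! ### From bounds on likely events to convergence in probability -/

section Probability

variable {Ω : Type*} [MeasurableSpace Ω] {P : Measure Ω}

theorem tendstoInMeasure_of_abs_sub_le {E : ℕ → Set Ω}
    (hE : Tendsto (fun n => P (E n)ᶜ) atTop (𝓝 0)) {f : ℕ → Ω → ℝ} {c : ℝ} {b : ℕ → ℝ}
    (hb : Tendsto b atTop (𝓝 0)) (h : ∀ᶠ n in atTop, ∀ ω ∈ E n, |f n ω - c| ≤ b n) :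
    TendstoInMeasure P f atTop (fun _ => c) := by
  rw [tendstoInMeasure_iff_dist]
  intro ε hε
  refine tendsto_of_tendsto_of_tendsto_of_le_of_le' tendsto_const_nhds hE
    (Eventually.of_forall fun _ => zero_le) ?_
  filter_upwards [h, hb.eventually_lt_const hε] with n hn hbn
  refine measure_mono fun ω hω hωE => ?_
  have h1 : ε ≤ dist (f n ω) c := hω
  rw [Real.dist_eq] at h1
  linarith [hn ω hωE]

theorem tendstoInProbAtTop_of_le {E : ℕ → Set Ω}
    (hE : Tendsto (fun n => P (E n)ᶜ) atTop (𝓝 0)) {f : ℕ → Ω → ℝ} {b : ℕ → ℝ}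
    (hb : Tendsto b atTop atTop) (h : ∀ᶠ n in atTop, ∀ ω ∈ E n, b n ≤ f n ω) :
    TendstoInProbAtTop P f := by
  intro M
  refine tendsto_of_tendsto_of_tendsto_of_le_of_le' tendsto_const_nhds hE
    (Eventually.of_forall fun _ => zero_le) ?_
  filter_upwards [h, hb.eventually_gt_atTop M] with n hn hbn
  refine measure_mono fun ω hω hωE => ?_
  have h1 : f n ω ≤ M := hω
  linarith [hn ω hωE]

theorem not_tendstoInMeasure_one [IsProbabilityMeasure P] {f : ℕ → Ω → ℝ} {b : ℕ → ℝ} {c : ℝ}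
    (hc : c < 1) (hb : Tendsto b atTop (𝓝 c)) (h : ∀ᶠ n in atTop, ∀ᵐ ω ∂P, f n ω ≤ b n) :
    ¬ TendstoInMeasure P f atTop (fun _ => 1) := by
  rw [tendstoInMeasure_iff_dist]
  intro hf
  have h1 := hf ((1 - c) / 2) (by linarith)
  have h2 : ∀ᶠ n in atTop, P {ω | (1 - c) / 2 ≤ dist (f n ω) 1} = 1 := by
    filter_upwards [h, hb.eventually_lt_const (show c < (1 + c) / 2 by linarith)] with n hn hbn
    have hae : ∀ᵐ ω ∂P, (1 - c) / 2 ≤ dist (f n ω) 1 := by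
      filter_upwards [hn] with ω hω
      rw [Real.dist_eq, abs_sub_comm]
      exact le_trans (by linarith) (le_abs_self _)
    rw [← measure_univ (μ := P)]
    exact measure_congr (eventuallyEq_univ.2 hae)
  have h3 := tendsto_nhds_unique h1 (tendsto_const_nhds.congr' (EventuallyEq.symm h2))
  exact zero_ne_one h3

end Probability

/-! ### Asymptotics of the scale `(1+nφ)/n²` and of the error terms -/

section Asymptotics

theorem sub_div_sqrt_eq (x t : ℝ) {n : ℕ} (hn : 1 ≤ n) :
    ((n : ℝ) - t) / √x = (1 - t / n) * (√(x / (n : ℝ) ^ 2))⁻¹ := by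
  have hn' : (0 : ℝ) < n := by positivity
  rw [Real.sqrt_div' _ (by positivity), Real.sqrt_sq hn'.le]
  field_simp

theorem tendsto_one_sub_div_natCast (t : ℝ) :
    Tendsto (fun n : ℕ => 1 - t / (n : ℝ)) atTop (𝓝 1) := by
  simpa using (tendsto_const_nhds (x := (1 : ℝ))).sub (tendsto_const_div_atTop_nhds_zero_nat t)

theorem tendsto_inv_one_add_sub_div_sqrt {φ : ℕ → ℝ} (t : ℝ)
    (h : Tendsto (fun n : ℕ => (1 + n * φ n) / (n : ℝ) ^ 2) atTop (𝓝 0))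
    (hpos : ∀ n, 1 ≤ n → 0 < φ n) :
    Tendsto (fun n : ℕ => (1 + ((n : ℝ) - t) / √(1 + n * φ n))⁻¹) atTop (𝓝 0) := by
  have h1 : Tendsto (fun n : ℕ => √((1 + n * φ n) / (n : ℝ) ^ 2)) atTop (𝓝[>] 0) := by
    refine tendsto_nhdsWithin_iff.2 ⟨by simpa using h.sqrt, ?_⟩
    filter_upwards [eventually_ge_atTop 1] with n hn
    have := hpos n hn
    exact Real.sqrt_pos.2 (by positivity)
  have h2 := Tendsto.pos_mul_atTop one_pos (tendsto_one_sub_div_natCast t)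
    (tendsto_inv_nhdsGT_zero.comp h1)
  refine Tendsto.congr' ?_ (tendsto_inv_atTop_zero.comp (tendsto_atTop_add_const_left _ 1 h2))
  filter_upwards [eventually_ge_atTop 1] with n hn
  simp only [Function.comp_apply, sub_div_sqrt_eq _ _ hn]

theorem tendsto_inv_one_add_sub_div_sqrt_of_pos {φ : ℕ → ℝ} (t : ℝ) {c : ℝ} (hc : 0 < c)
    (h : Tendsto (fun n : ℕ => (1 + n * φ n) / (n : ℝ) ^ 2) atTop (𝓝 c)) :
    Tendsto (fun n : ℕ => (1 + ((n : ℝ) - t) / √(1 + n * φ n))⁻¹) atTop (𝓝 (1 + (√c)⁻¹)⁻¹) := by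
  have hc' : 0 < √c := Real.sqrt_pos.2 hc
  have h1 := (tendsto_one_sub_div_natCast t).mul (h.sqrt.inv₀ hc'.ne')
  rw [one_mul] at h1
  refine Tendsto.congr' ?_ ((h1.const_add 1).inv₀ (by positivity))
  filter_upwards [eventually_ge_atTop 1] with n hn
  rw [sub_div_sqrt_eq _ _ hn]

theorem tendsto_div_sqrt_of_atTop {φ : ℕ → ℝ}
    (h : Tendsto (fun n : ℕ => (1 + n * φ n) / (n : ℝ) ^ 2) atTop atTop) :
    Tendsto (fun n : ℕ => (n : ℝ) * (√(1 + n * φ n))⁻¹) atTop (𝓝 0) := by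
  refine Tendsto.congr' ?_ (tendsto_inv_atTop_zero.comp (Real.tendsto_sqrt_atTop.comp h))
  filter_upwards [eventually_ge_atTop 1] with n hn
  have := sub_div_sqrt_eq (1 + n * φ n) 0 hn
  simp only [sub_zero, zero_div, one_mul] at this
  rw [← div_eq_mul_inv, this, Function.comp_apply, Function.comp_apply]

section PowerScale

variable {c₂ δ₂ : ℝ} {φ : ℕ → ℝ}

theorem one_add_mul_div_sq (hφ : ∀ n : ℕ, 1 ≤ n → φ n = c₂ * (n : ℝ) ^ δ₂) {n : ℕ} (hn : 1 ≤ n) :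
    (1 + n * φ n) / (n : ℝ) ^ 2 = ((n : ℝ) ^ 2)⁻¹ + c₂ * (n : ℝ) ^ (δ₂ - 1) := by
  have hn' : (0 : ℝ) < n := by positivity
  rw [hφ n hn, Real.rpow_sub_one hn'.ne']
  field_simp

theorem tendsto_inv_natCast_sq : Tendsto (fun n : ℕ => ((n : ℝ) ^ 2)⁻¹) atTop (𝓝 0) :=
  tendsto_inv_atTop_zero.comp
    ((tendsto_pow_atTop two_ne_zero).comp tendsto_natCast_atTop_atTop)

theorem tendsto_ratio_of_lt_one (hφ : ∀ n : ℕ, 1 ≤ n → φ n = c₂ * (n : ℝ) ^ δ₂) (h : δ₂ < 1) :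
    Tendsto (fun n : ℕ => (1 + n * φ n) / (n : ℝ) ^ 2) atTop (𝓝 0) := by
  have h1 : Tendsto (fun n : ℕ => (n : ℝ) ^ (-(1 - δ₂))) atTop (𝓝 0) :=
    (tendsto_rpow_neg_atTop (by linarith)).comp tendsto_natCast_atTop_atTop
  have h2 := tendsto_inv_natCast_sq.add (h1.const_mul c₂)
  rw [mul_zero, add_zero] at h2
  refine h2.congr' ?_
  filter_upwards [eventually_ge_atTop 1] with n hn
  rw [one_add_mul_div_sq hφ hn, neg_sub]

theorem tendsto_ratio_of_eq_one (hφ : ∀ n : ℕ, 1 ≤ n → φ n = c₂ * (n : ℝ) ^ δ₂) (h : δ₂ = 1) :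
    Tendsto (fun n : ℕ => (1 + n * φ n) / (n : ℝ) ^ 2) atTop (𝓝 c₂) := by
  have h2 := tendsto_inv_natCast_sq.add_const c₂
  rw [zero_add] at h2
  refine h2.congr' ?_
  filter_upwards [eventually_ge_atTop 1] with n hn
  rw [one_add_mul_div_sq hφ hn, h, sub_self, Real.rpow_zero, mul_one]

theorem tendsto_ratio_of_one_lt (hc₂ : 0 < c₂)
    (hφ : ∀ n : ℕ, 1 ≤ n → φ n = c₂ * (n : ℝ) ^ δ₂) (h : 1 < δ₂) :
    Tendsto (fun n : ℕ => (1 + n * φ n) / (n : ℝ) ^ 2) atTop atTop := by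
  have h1 : Tendsto (fun n : ℕ => (n : ℝ) ^ (δ₂ - 1)) atTop atTop :=
    (tendsto_rpow_atTop (by linarith)).comp tendsto_natCast_atTop_atTop
  refine (tendsto_inv_natCast_sq.add_atTop (h1.const_mul_atTop hc₂)).congr' ?_
  filter_upwards [eventually_ge_atTop 1] with n hn
  rw [one_add_mul_div_sq hφ hn]

theorem tendsto_sqrt_one_add_mul (hc₂ : 0 < c₂)
    (hφ : ∀ n : ℕ, 1 ≤ n → φ n = c₂ * (n : ℝ) ^ δ₂) (h : -1 < δ₂) :
    Tendsto (fun n : ℕ => √(1 + n * φ n)) atTop atTop := by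
  have h1 : Tendsto (fun n : ℕ => (n : ℝ) ^ (1 + δ₂)) atTop atTop :=
    (tendsto_rpow_atTop (by linarith)).comp tendsto_natCast_atTop_atTop
  refine Real.tendsto_sqrt_atTop.comp
    (tendsto_atTop_add_const_left _ 1 ((h1.const_mul_atTop hc₂).congr' ?_))
  filter_upwards [eventually_ge_atTop 1] with n hn
  have hn' : (0 : ℝ) < n := by positivity
  rw [hφ n hn, Real.rpow_add hn', Real.rpow_one]
  ring

end PowerScale

/-- With `x = √K/r ≤ 1/4` the tail is at most `r^s x^n = √K^s x^(n-s)`. The threshold `1/4` is what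
lets the decay beat the `2^n` models. -/
theorem two_pow_mul_tail_le {r K q : ℝ} {s n : ℕ} (hsn : s ≤ n) (hK : 0 < K) (hr : 4 * √K ≤ r)
    (hq : n / 2 ≤ q) :
    2 ^ n * (r ^ s * (K / r ^ 2) ^ q) ≤ √K ^ s * 4 ^ s * (1 / 2) ^ n := by
  have hsK : 0 < √K := Real.sqrt_pos.2 hK
  have hr0 : 0 < r := by linarith
  have hx : √K / r ≤ 1 / 4 := by
    rw [div_le_iff₀ hr0]; linarith
  have hbase : K / r ^ 2 = (√K / r) ^ 2 := by rw [div_pow, Real.sq_sqrt hK.le]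
  have h1 : (K / r ^ 2) ^ q ≤ (√K / r) ^ n := by
    rw [hbase]
    calc ((√K / r) ^ 2) ^ q ≤ ((√K / r) ^ 2) ^ ((n : ℝ) / 2) :=
          Real.rpow_le_rpow_of_exponent_ge (by positivity)
            (pow_le_one₀ (by positivity) (by linarith)) hq
      _ = (√K / r) ^ n := by
          rw [← Real.rpow_natCast, ← Real.rpow_mul (by positivity), ← Real.rpow_natCast]
          congr 1
          push_cast
          ring
  obtain ⟨m, rfl⟩ := Nat.exists_eq_add_of_le hsn
  calc 2 ^ (s + m) * (r ^ s * (K / r ^ 2) ^ q)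
      ≤ 2 ^ (s + m) * (r ^ s * (√K / r) ^ (s + m)) := by gcongr
    _ = 2 ^ (s + m) * (√K ^ s * (√K / r) ^ m) := by
        rw [pow_add (√K / r), div_pow √K r s]
        field_simp
    _ ≤ 2 ^ (s + m) * (√K ^ s * (1 / 4) ^ m) := by gcongr
    _ = √K ^ s * 4 ^ s * (1 / 2) ^ (s + m) := by
        rw [show (4 : ℝ) = 2 * 2 by norm_num, pow_add, pow_add, one_div, one_div, mul_inv]
        simp only [mul_pow, inv_pow]
        field_simp

/-- This is the signal condition `L²(1+nφ) ≤ Mψ²` for `L = log n` and `M = (1+c₂)/c₁`; here `δ₂ ≤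
δ₁` is decisive. -/
theorem rpow_mul_log_le {c₁ c₂ δ₁ δ₂ : ℝ} (hc₁ : 0 < c₁) (hc₂ : 0 < c₂) (hδ₁ : -1 ≤ δ₁)
    (h : δ₂ ≤ δ₁) {n : ℕ} (hn : 1 ≤ n) :
    Real.log n ^ 2 * (1 + n * (c₂ * (n : ℝ) ^ δ₂)) ≤
      (1 + c₂) / c₁ * (c₁ * (n : ℝ) ^ (1 + δ₁) * Real.log n ^ 2) := by
  have hn1 : (1 : ℝ) ≤ n := by exact_mod_cast hn
  have h1 : (1 : ℝ) ≤ (n : ℝ) ^ (1 + δ₁) := Real.one_le_rpow hn1 (by linarith)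
  have h2 : (n : ℝ) * (n : ℝ) ^ δ₂ ≤ (n : ℝ) ^ (1 + δ₁) := by
    rw [Real.rpow_add (by positivity), Real.rpow_one]
    gcongr
  calc Real.log n ^ 2 * (1 + n * (c₂ * (n : ℝ) ^ δ₂))
      = Real.log n ^ 2 * (1 + c₂ * (n * (n : ℝ) ^ δ₂)) := by ring
    _ ≤ Real.log n ^ 2 * ((n : ℝ) ^ (1 + δ₁) + c₂ * (n : ℝ) ^ (1 + δ₁)) := by gcongr
    _ = _ := by field_simp

/-- Bounding `log n` crudely by `n` gives the power `4+δ₁`; one more power of `n` absorbs the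
constant `3+2Cc₁`. -/
theorem eventually_dispersion_bound_le {c₁ δ₁ C : ℝ} (hc₁ : 0 < c₁) (hδ₁ : 0 < δ₁) (hC : 0 ≤ C) :
    ∀ᶠ n : ℕ in atTop, 1 + (2 * n * (C * (c₁ * (n : ℝ) ^ (1 + δ₁) * Real.log n ^ 2)) +
      2 * n * Real.log n ^ 2) ≤ (n : ℝ) ^ (5 + δ₁) := by
  filter_upwards [eventually_ge_atTop 1,
    tendsto_natCast_atTop_atTop.eventually_ge_atTop (3 + 2 * C * c₁)] with n hn hnC
  have hn1 : (1 : ℝ) ≤ n := by exact_mod_cast hn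
  have hn0 : (0 : ℝ) < n := by positivity
  have hlog : Real.log n ^ 2 ≤ (n : ℝ) ^ 2 := by
    have h0 := Real.log_nonneg hn1
    gcongr
    exact (Real.log_le_sub_one_of_pos hn0).trans (by linarith)
  have h4 : (n : ℝ) ^ (4 + δ₁) = n * (n : ℝ) ^ (1 + δ₁) * (n : ℝ) ^ 2 := by
    rw [← Real.rpow_natCast, ← Real.rpow_one_add' hn0.le (by linarith), ← Real.rpow_add hn0]
    congr 1
    push_cast
    ring
  have h5 : (n : ℝ) ^ (5 + δ₁) = n * (n : ℝ) ^ (4 + δ₁) := by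
    rw [← Real.rpow_one_add' hn0.le (by linarith)]
    congr 1
    ring
  have h1 : (1 : ℝ) ≤ (n : ℝ) ^ (1 + δ₁) := Real.one_le_rpow hn1 (by linarith)
  have h1' : (1 : ℝ) ≤ (n : ℝ) ^ (4 + δ₁) := Real.one_le_rpow hn1 (by linarith)
  calc 1 + (2 * n * (C * (c₁ * (n : ℝ) ^ (1 + δ₁) * Real.log n ^ 2)) + 2 * n * Real.log n ^ 2)
      ≤ (n : ℝ) ^ (4 + δ₁) + (2 * n * (C * (c₁ * (n : ℝ) ^ (1 + δ₁) * (n : ℝ) ^ 2)) +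
        2 * (n * (n : ℝ) ^ (1 + δ₁) * (n : ℝ) ^ 2)) := by
        have h6 : (n : ℝ) * Real.log n ^ 2 ≤ n * (n : ℝ) ^ (1 + δ₁) * (n : ℝ) ^ 2 := by
          gcongr
          nlinarith
        have h7 : 2 * n * (C * (c₁ * (n : ℝ) ^ (1 + δ₁) * Real.log n ^ 2)) ≤
            2 * n * (C * (c₁ * (n : ℝ) ^ (1 + δ₁) * (n : ℝ) ^ 2)) := by gcongr
        linarith
    _ = (3 + 2 * C * c₁) * (n : ℝ) ^ (4 + δ₁) := by rw [h4]; ring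
    _ ≤ _ := by rw [h5]; gcongr

theorem eventually_natCast_le_sqrt_mul_rpow {φ : ℕ → ℝ} {ν κ : ℝ} (hν : 0 < ν) (hκ : 0 < κ)
    (hφ : ∀ n, 1 ≤ n → 0 < φ n)
    (h : (fun n : ℕ => (n : ℝ) ^ ((n : ℝ) * Real.log n)) =O[atTop] φ) :
    ∀ᶠ n : ℕ in atTop, (n : ℝ) ≤ √(1 + n * φ n) * ((n : ℝ) ^ κ) ^ (-((n + ν) / 2)) := by
  obtain ⟨c, hc, hcφ⟩ := h.exists_pos
  have hlog : Tendsto (fun n : ℕ => Real.log n) atTop atTop :=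
    Real.tendsto_log_atTop.comp tendsto_natCast_atTop_atTop
  filter_upwards [eventually_ge_atTop 1, tendsto_natCast_atTop_atTop.eventually_ge_atTop c,
    hcφ.bound, hlog.eventually_ge_atTop (κ + κ * ν + 2)] with n hn hnc hb hl
  have hn1 : (1 : ℝ) ≤ n := by exact_mod_cast hn
  have hn0 : (0 : ℝ) < n := by positivity
  have hφn := hφ n hn
  rw [Real.norm_of_nonneg (by positivity), Real.norm_of_nonneg hφn.le] at hb
  have h1 : (n : ℝ) ^ ((n : ℝ) * Real.log n / 2) ≤ √(1 + n * φ n) := by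
    refine Real.le_sqrt_of_sq_le ?_
    rw [← Real.rpow_natCast, ← Real.rpow_mul hn0.le]
    have : (n : ℝ) * Real.log n / 2 * (2 : ℕ) = n * Real.log n := by push_cast; ring
    rw [this]
    -- The `O`-constant `c` is at most `n`, so `n^(n log n) ≤ cφ ≤ nφ`.
    nlinarith
  have hκν : 0 < κ * ν := by positivity
  calc (n : ℝ) = (n : ℝ) ^ (1 : ℝ) := (Real.rpow_one _).symm
    _ ≤ (n : ℝ) ^ ((n : ℝ) * Real.log n / 2 + κ * (-((n + ν) / 2))) := by
        refine Real.rpow_le_rpow_of_exponent_le hn1 ?_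
        nlinarith
    _ = (n : ℝ) ^ ((n : ℝ) * Real.log n / 2) * ((n : ℝ) ^ κ) ^ (-((n + ν) / 2)) := by
        rw [Real.rpow_add hn0, Real.rpow_mul hn0.le]
    _ ≤ _ := by gcongr

end Asymptotics

/-! ### From odds bounds to the maximal odds and the posterior -/

section Bounds

variable {n : ℕ} {X : Matrix (Fin n) (Fin n) ℝ} {ν φ θ τ : ℝ} {y : Fin n → ℝ}
  {γ₀ : Finset (Fin n)}

theorem abs_maxPosteriorOdds_le (hn : 1 ≤ n)
    (hX : Xᵀ * X = (n : ℝ) • (1 : Matrix (Fin n) (Fin n) ℝ)) (hν : 0 < ν) (hφ : 0 < φ)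
    (hθ : 0 ≤ θ) (hθ1 : θ ≤ 1) (hτ : 0 ≤ τ)
    (h1 : ∀ γ, γ₀ ⊆ γ →
      posteriorOdds ν (fun _ => φ) (flatPrior n) X y γ₀ γ ≤ θ ^ (γ \ γ₀).card)
    (h2 : ∀ γ, ¬ γ₀ ⊆ γ → posteriorOdds ν (fun _ => φ) (flatPrior n) X y γ₀ γ ≤ τ) :
    |maxPosteriorOdds ν (fun _ => φ) (flatPrior n) X y γ₀| ≤ θ + τ := by
  rw [maxPosteriorOdds, abs_of_nonneg (Real.iSup_nonneg fun γ : {γ // γ ≠ γ₀} =>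
    posteriorOdds_nonneg (γ₀ := γ₀) hn hX hν hφ y γ.1)]
  refine Real.iSup_le (fun ⟨γ, hγ⟩ => ?_) (by positivity)
  by_cases h : γ₀ ⊆ γ
  · have hcard : (γ \ γ₀).card ≠ 0 := by
      rw [Finset.card_ne_zero, Finset.sdiff_nonempty]
      exact fun h' => hγ (h'.antisymm h)
    have := pow_le_of_le_one hθ hθ1 hcard
    linarith [h1 γ h]
  · linarith [h2 γ h]

theorem abs_posteriorProb_sub_one_le (hn : 1 ≤ n)
    (hX : Xᵀ * X = (n : ℝ) • (1 : Matrix (Fin n) (Fin n) ℝ)) (hν : 0 < ν) (hφ : 0 < φ)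
    (hθ : 0 ≤ θ) (hτ : 0 ≤ τ)
    (h1 : ∀ γ, γ₀ ⊆ γ →
      posteriorOdds ν (fun _ => φ) (flatPrior n) X y γ₀ γ ≤ θ ^ (γ \ γ₀).card)
    (h2 : ∀ γ, ¬ γ₀ ⊆ γ → posteriorOdds ν (fun _ => φ) (flatPrior n) X y γ₀ γ ≤ τ) :
    |posteriorProb ν (fun _ => φ) (flatPrior n) X y γ₀ - 1| ≤
      Real.exp (n * θ) - 1 + 2 ^ n * τ := by
  have hle := posteriorProb_le_one hn hX hν hφ y γ₀
  have hS := sum_le_of_bounds hθ hτ h1 h2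
  have hexp : (1 + θ) ^ n ≤ Real.exp (n * θ) := by
    rw [Real.exp_nat_mul]
    have := Real.add_one_le_exp θ
    gcongr
    linarith
  rw [posteriorProb_eq_inv_sum hn hX hν hφ] at hle ⊢
  set S := ∑ γ, posteriorOdds ν (fun _ => φ) (flatPrior n) X y γ₀ γ
  rw [abs_sub_comm, abs_of_nonneg (by linarith)]
  -- `S ≥ 1` because the odds of `γ₀` against itself equal 1; the inequality is then `S + S⁻¹ ≥ 2`.
  have h3 : 1 - S⁻¹ ≤ S - 1 := by
    have hodds : posteriorOdds ν (fun _ => φ) (flatPrior n) X y γ₀ γ₀ = 1 := by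
      rw [posteriorOdds_eq hn hX hν hφ]
      exact div_self (modelWeight_pos (by positivity) _ _ _).ne'
    have h4 : 1 ≤ S := hodds ▸ Finset.single_le_sum
      (f := fun γ => posteriorOdds ν (fun _ => φ) (flatPrior n) X y γ₀ γ)
      (fun γ _ => posteriorOdds_nonneg hn hX hν hφ y γ) (Finset.mem_univ γ₀)
    have h5 : S * S⁻¹ = 1 := mul_inv_cancel₀ (by linarith)
    have h6 : 0 < S⁻¹ := inv_pos.2 (by linarith)
    nlinarith [sq_nonneg (S - 1)]
  linarith

end Bounds

end BVS

end

/-! ### The main theorem -/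

theorem mainTheorem2 {Ω : Type*} [MeasurableSpace Ω] (P : Measure Ω) [IsProbabilityMeasure P]
    (ν σ₀ c₁ δ₁ : ℝ) (hν : 0 < ν) (hσ₀ : 0 < σ₀) (hc₁ : 0 < c₁) (hδ₁ : 1 < δ₁)
    (s : ℕ) (hs : 0 < s)
    -- the design, possibly random, with `p = n` and `XᵀX = n I`
    (X : (n : ℕ) → Ω → Matrix (Fin n) (Fin n) ℝ)
    (hXmeas : ∀ n i j, Measurable fun ω => X n ω i j)
    (hX : ∀ n, ∀ᵐ ω ∂P, (X n ω)ᵀ * X n ω = (n : ℝ) • (1 : Matrix (Fin n) (Fin n) ℝ))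
    -- the errors, with law `N(0, σ₀² I_n)`, independent of the design
    (ε : (n : ℕ) → Ω → Fin n → ℝ)
    (hε : ∀ n, HasLaw (ε n) (Measure.pi fun _ => gaussianReal 0 (σ₀ ^ 2).toNNReal) P)
    (hindep : ∀ n, IndepFun (fun ω (i j : Fin n) => X n ω i j) (ε n) P)
    -- the true coefficients
    (β₀ : (n : ℕ) → Fin n → ℝ)
    (hcard : ∀ᶠ n in atTop, (BVS.stateVector (β₀ n)).card = s)
    (ψ : ℕ → ℝ) (hψ_nonneg : ∀ n, 0 ≤ ψ n)
    (hψ : ∀ n : ℕ, ψ n ^ 2 = c₁ * (n : ℝ) ^ (1 + δ₁) * Real.log n ^ 2)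
    (hβ₀ : ∀ᶠ n in atTop, ∀ j ∈ BVS.stateVector (β₀ n), ψ n ≤ |β₀ n j|)
    (hk : (fun n => ∑ j, β₀ n j ^ 2) =O[atTop] fun n => ψ n ^ 2)
    -- the responses
    (y : (n : ℕ) → Ω → Fin n → ℝ) (hy : ∀ n ω, y n ω = X n ω *ᵥ β₀ n + ε n ω)
    -- `post φ n ω γ = p(γ | Z)`, `odds φ n ω γ = p(γ | Z) / p(γ⁰ | Z)` and
    -- `maxOdds φ n ω = max_{γ ≠ γ⁰} p(γ | Z) / p(γ⁰ | Z)` when `Σ = φ n • I` and the prior is flat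
    (post odds : (ℕ → ℝ) → (n : ℕ) → Ω → Finset (Fin n) → ℝ)
    (hpost : post = fun φ n ω γ =>
      BVS.posteriorProb ν (fun _ => φ n) (BVS.flatPrior n) (X n ω) (y n ω) γ)
    (hodds : odds = fun φ n ω γ =>
      BVS.posteriorOdds ν (fun _ => φ n) (BVS.flatPrior n) (X n ω) (y n ω)
        (BVS.stateVector (β₀ n)) γ)
    (maxOdds : (ℕ → ℝ) → ℕ → Ω → ℝ)
    (hmaxOdds : maxOdds = fun φ n ω =>
      BVS.maxPosteriorOdds ν (fun _ => φ n) (BVS.flatPrior n) (X n ω) (y n ω)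
        (BVS.stateVector (β₀ n))) :
    -- (a)
    (∀ (c₂ δ₂ : ℝ) (φ : ℕ → ℝ), 0 < c₂ → (∀ n : ℕ, 1 ≤ n → φ n = c₂ * (n : ℝ) ^ δ₂) →
      -- i.
      (-1 < δ₂ → δ₂ ≤ 1 →
        TendstoInMeasure P (maxOdds φ) atTop (fun _ => 0) ∧
        ¬ TendstoInMeasure P (fun n ω => post φ n ω (BVS.stateVector (β₀ n))) atTop (fun _ => 1) ∧
        (δ₂ < 1 → ∀ᵐ ω ∂P,
          Tendsto (fun n => post φ n ω (BVS.stateVector (β₀ n))) atTop (𝓝 0)) ∧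
        (δ₂ = 1 → ∃ c₀ : ℝ, 0 < c₀ ∧ c₀ < 1 ∧ ∀ᵐ ω ∂P,
          limsup (fun n => (post φ n ω (BVS.stateVector (β₀ n)) : EReal)) atTop ≤ (c₀ : EReal))) ∧
      -- ii.
      (1 < δ₂ → δ₂ ≤ δ₁ →
        TendstoInMeasure P (fun n ω => post φ n ω (BVS.stateVector (β₀ n))) atTop (fun _ => 1))) ∧
    -- (b)
    (∀ φ : ℕ → ℝ, (∀ n, 1 ≤ n → 0 < φ n) →
      (fun n : ℕ => (n : ℝ) ^ ((n : ℝ) * Real.log n)) =O[atTop] φ →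
      BVS.TendstoInProbAtTop P (fun n ω => odds φ n ω ∅) ∧
      TendstoInMeasure P (fun n ω => post φ n ω (BVS.stateVector (β₀ n))) atTop (fun _ => 0)) ∧
    -- (c)
    (∀ (φ : ℕ → ℝ) (η : ℝ), (∀ n, 1 ≤ n → 0 < φ n) → 0 ≤ η →
      Tendsto (fun n : ℕ => (n : ℝ) * φ n) atTop (𝓝 η) →
      ∀ᵐ ω ∂P,
        (((1 + η) ^ (-(1 / 2) : ℝ) : ℝ) : EReal) ≤
          liminf (fun n => (maxOdds φ n ω : EReal)) atTop ∧
        Tendsto (fun n => post φ n ω (BVS.stateVector (β₀ n))) atTop (𝓝 0)) := by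
  obtain rfl : y = fun n ω => X n ω *ᵥ β₀ n + ε n ω := by
    funext n ω
    exact hy n ω
  subst hpost hodds hmaxOdds
  -- The good event includes the design identity, so the deterministic lemmas apply at each of its
  -- points.
  let G : ℕ → Set Ω := fun n => {ω | (X n ω)ᵀ * X n ω = (n : ℝ) • (1 : Matrix (Fin n) (Fin n) ℝ) ∧
    ∀ j, |BVS.score (X n ω) (ε n ω) j| ≤ Real.log n}
  have hG : Tendsto (fun n => P (G n)ᶜ) atTop (𝓝 0) := by
    have hlim : Tendsto (fun n : ℕ => ENNReal.ofReal
        (2 * Real.exp (2 * ((σ₀ ^ 2).toNNReal : ℝ)) / n)) atTop (𝓝 0) := by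
      rw [← ENNReal.ofReal_zero]
      exact ENNReal.tendsto_ofReal (tendsto_const_div_atTop_nhds_zero_nat _)
    refine tendsto_of_tendsto_of_tendsto_of_le_of_le' tendsto_const_nhds hlim
      (Eventually.of_forall fun _ => zero_le) ?_
    filter_upwards [eventually_ge_atTop 1] with n hn
    refine le_trans (measure_mono_ae ?_)
      (BVS.measure_exists_score_gt_le hn (hXmeas n) (hX n) (hε n) (hindep n))
    filter_upwards [hX n] with ω hω hωG h
    exact hωG ⟨hω, h⟩
  -- The only null set behind the almost sure claims: those bounds do not involve the noise event.
  have hXae : ∀ᵐ ω ∂P, ∀ n, (X n ω)ᵀ * X n ω = (n : ℝ) • (1 : Matrix (Fin n) (Fin n) ℝ) :=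
    ae_all_iff.2 hX
  obtain ⟨C, hC, hk'⟩ := hk.exists_nonneg
  have hβsum : ∀ᶠ n in atTop, ∑ j, β₀ n j ^ 2 ≤ C * ψ n ^ 2 := by
    filter_upwards [hk'.bound] with n hn
    rwa [Real.norm_of_nonneg (Finset.sum_nonneg fun j _ => sq_nonneg _),
      Real.norm_of_nonneg (sq_nonneg _)] at hn
  have hlog : Tendsto (fun n : ℕ => Real.log n) atTop atTop :=
    Real.tendsto_log_atTop.comp tendsto_natCast_atTop_atTop
  have hpost_le : ∀ φ : ℕ → ℝ, (∀ n, 1 ≤ n → 0 < φ n) → ∀ᶠ n in atTop, ∀ ω,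
      (X n ω)ᵀ * X n ω = (n : ℝ) • (1 : Matrix (Fin n) (Fin n) ℝ) →
      0 ≤ BVS.posteriorProb ν (fun _ => φ n) (BVS.flatPrior n) (X n ω) (X n ω *ᵥ β₀ n + ε n ω)
        (BVS.stateVector (β₀ n)) ∧
      BVS.posteriorProb ν (fun _ => φ n) (BVS.flatPrior n) (X n ω) (X n ω *ᵥ β₀ n + ε n ω)
        (BVS.stateVector (β₀ n)) ≤ (1 + ((n : ℝ) - (s : ℝ)) / √(1 + n * φ n))⁻¹ := by
    intro φ hφ
    filter_upwards [eventually_ge_atTop 1, hcard] with n hn hs' ω hω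
    refine ⟨BVS.posteriorProb_nonneg hn hω hν (hφ n hn) _ _, ?_⟩
    have := BVS.posteriorProb_le hn hω hν (hφ n hn) (X n ω *ᵥ β₀ n + ε n ω)
      (BVS.stateVector (β₀ n))
    rwa [hs'] at this
  have hpost_zero : ∀ φ : ℕ → ℝ, (∀ n, 1 ≤ n → 0 < φ n) →
      Tendsto (fun n : ℕ => (1 + n * φ n) / (n : ℝ) ^ 2) atTop (𝓝 0) → ∀ ω,
      (∀ n, (X n ω)ᵀ * X n ω = (n : ℝ) • (1 : Matrix (Fin n) (Fin n) ℝ)) →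
      Tendsto (fun n => BVS.posteriorProb ν (fun _ => φ n) (BVS.flatPrior n) (X n ω)
        (X n ω *ᵥ β₀ n + ε n ω) (BVS.stateVector (β₀ n))) atTop (𝓝 0) := by
    intro φ hφ hd ω hω
    refine tendsto_of_tendsto_of_tendsto_of_le_of_le' tendsto_const_nhds
      (BVS.tendsto_inv_one_add_sub_div_sqrt s hd hφ) ?_ ?_
    · filter_upwards [hpost_le φ hφ] with n hn using (hn ω (hω n)).1
    · filter_upwards [hpost_le φ hφ] with n hn using (hn ω (hω n)).2
  refine ⟨fun c₂ δ₂ φ hc₂ hφ => ?_, fun φ hφ hφO => ?_, fun φ η hφ hη hlim => ?_⟩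
  · have hφpos : ∀ n, 1 ≤ n → 0 < φ n := fun n hn => by
      have : (0 : ℝ) < n := by positivity
      rw [hφ n hn]
      positivity
    set M : ℝ := (1 + c₂) / c₁ with hMdef
    have hM : 0 < M := by positivity
    set K : ℝ := 8 * C + 16 * M with hKdef
    have hK : 0 < K := by positivity
    let θ : ℕ → ℝ := fun n => (√(1 + n * φ n))⁻¹ * Real.exp (2 * M * (1 + ν))
    let τ : ℕ → ℝ := fun n => √(1 + n * φ n) ^ s * (K / (1 + n * φ n)) ^ ((n + ν) / 2)
    have hτ0 : ∀ᶠ n in atTop, 0 ≤ τ n := by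
      filter_upwards [eventually_ge_atTop 1] with n hn
      have := hφpos n hn
      positivity
    have hodds : δ₂ ≤ δ₁ → ∀ᶠ n in atTop, ∀ ω ∈ G n, ∀ γ,
        (BVS.stateVector (β₀ n) ⊆ γ →
          BVS.posteriorOdds ν (fun _ => φ n) (BVS.flatPrior n) (X n ω) (X n ω *ᵥ β₀ n + ε n ω)
            (BVS.stateVector (β₀ n)) γ ≤ θ n ^ (γ \ BVS.stateVector (β₀ n)).card) ∧
        (¬ BVS.stateVector (β₀ n) ⊆ γ →
          BVS.posteriorOdds ν (fun _ => φ n) (BVS.flatPrior n) (X n ω) (X n ω *ᵥ β₀ n + ε n ω)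
            (BVS.stateVector (β₀ n)) γ ≤ τ n) := by
      intro hδ
      filter_upwards [eventually_ge_atTop 1, hcard, hβ₀, hβsum, hlog.eventually_ge_atTop 1,
        tendsto_natCast_atTop_atTop.eventually_ge_atTop (4 * M)]
        with n hn hs' hmin hsum hl hnM ω hω γ
      have hne : (BVS.stateVector (β₀ n)).Nonempty := Finset.card_pos.1 (hs' ▸ hs)
      have hLM : Real.log n ^ 2 * (1 + n * φ n) ≤ M * ψ n ^ 2 := by
        rw [hφ n hn, hψ n]
        exact BVS.rpow_mul_log_le hc₁ hc₂ (by linarith) hδ hn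
      have := BVS.posteriorOdds_le hn hω.1 hν (hφpos n hn) hC hM (hψ_nonneg n) hl hω.2 hsum hmin
        hne hLM hnM γ
      rwa [hs'] at this
    have htail : -1 < δ₂ → ∀ᶠ n : ℕ in atTop, 2 ^ n * τ n ≤ √K ^ s * 4 ^ s * (1 / 2) ^ n := by
      intro hδ
      filter_upwards [eventually_ge_atTop 1, eventually_ge_atTop s,
        (BVS.tendsto_sqrt_one_add_mul hc₂ hφ hδ).eventually_ge_atTop (4 * √K)] with n hn hsn hr
      have h := BVS.two_pow_mul_tail_le (q := (n + ν) / 2) hsn hK hr (by linarith)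
      have hp := hφpos n hn
      rwa [Real.sq_sqrt (by positivity)] at h
    have htail0 : Tendsto (fun n : ℕ => √K ^ s * 4 ^ s * (1 / 2 : ℝ) ^ n) atTop (𝓝 0) := by
      simpa using (tendsto_pow_atTop_nhds_zero_of_lt_one (r := (1 / 2 : ℝ)) (by norm_num)
        (by norm_num)).const_mul (√K ^ s * 4 ^ s)
    have hθ : -1 < δ₂ → Tendsto θ atTop (𝓝 0) := by
      intro hδ
      simpa using (tendsto_inv_atTop_zero.comp
        (BVS.tendsto_sqrt_one_add_mul hc₂ hφ hδ)).mul_const (Real.exp (2 * M * (1 + ν)))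
    refine ⟨fun hδ hδ' => ⟨?_, ?_, fun hlt => ?_, fun heq => ?_⟩, fun hδ hδ' => ?_⟩
    · have hb := (hθ hδ).add htail0
      rw [add_zero] at hb
      refine BVS.tendstoInMeasure_of_abs_sub_le hG hb ?_
      filter_upwards [eventually_ge_atTop 1, hodds (by linarith), htail hδ, hτ0,
        (hθ hδ).eventually_le_const one_pos] with n hn ho ht hτn hθ1 ω hω
      have h1 := BVS.abs_maxPosteriorOdds_le hn hω.1 hν (hφpos n hn) (θ := θ n) (τ := τ n)
        (by positivity) hθ1 hτn (fun γ => (ho ω hω γ).1) (fun γ => (ho ω hω γ).2)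
      -- The maximum needs no factor `2^n`, but the tail bound prepared for the sum serves here too.
      have h2 : τ n ≤ 2 ^ n * τ n := le_mul_of_one_le_left hτn (one_le_pow₀ one_le_two)
      rw [sub_zero]
      linarith
    · rcases hδ'.lt_or_eq with hlt | heq
      · refine BVS.not_tendstoInMeasure_one zero_lt_one
          (BVS.tendsto_inv_one_add_sub_div_sqrt s (BVS.tendsto_ratio_of_lt_one hφ hlt) hφpos) ?_
        filter_upwards [hpost_le φ hφpos] with n hn
        filter_upwards [hX n] with ω hω using (hn ω hω).2
      · refine BVS.not_tendstoInMeasure_one (c := (1 + (√c₂)⁻¹)⁻¹) ?_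
          (BVS.tendsto_inv_one_add_sub_div_sqrt_of_pos s hc₂
            (BVS.tendsto_ratio_of_eq_one hφ heq)) ?_
        · have : 0 < √c₂ := Real.sqrt_pos.2 hc₂
          exact inv_lt_one_of_one_lt₀ (by linarith [inv_pos.2 this])
        · filter_upwards [hpost_le φ hφpos] with n hn
          filter_upwards [hX n] with ω hω using (hn ω hω).2
    · filter_upwards [hXae] with ω hω
      exact hpost_zero φ hφpos (BVS.tendsto_ratio_of_lt_one hφ hlt) ω hω
    · have hsq : 0 < √c₂ := Real.sqrt_pos.2 hc₂
      -- For `δ₂ = 1` the ratio `(1+nφ)/n²` tends to `c₂`, so this is the limit of the deterministic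
      -- upper bound.
      refine ⟨(1 + (√c₂)⁻¹)⁻¹, by positivity,
        inv_lt_one_of_one_lt₀ (by linarith [inv_pos.2 hsq]), ?_⟩
      filter_upwards [hXae] with ω hω
      have hb := (continuous_coe_real_ereal.tendsto _).comp
        (BVS.tendsto_inv_one_add_sub_div_sqrt_of_pos s hc₂ (BVS.tendsto_ratio_of_eq_one hφ heq))
      rw [← hb.limsup_eq]
      refine limsup_le_limsup ?_
      filter_upwards [hpost_le φ hφpos] with n hn
      exact EReal.coe_le_coe_iff.2 (hn ω (hω n)).2
    · have hδ0 : -1 < δ₂ := by linarith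
      have hnθ : Tendsto (fun n : ℕ => (n : ℝ) * θ n) atTop (𝓝 0) := by
        simpa [θ, mul_assoc] using (BVS.tendsto_div_sqrt_of_atTop
          (BVS.tendsto_ratio_of_one_lt hc₂ hφ hδ)).mul_const (Real.exp (2 * M * (1 + ν)))
      have hb : Tendsto (fun n : ℕ => Real.exp (n * θ n) - 1 + √K ^ s * 4 ^ s * (1 / 2 : ℝ) ^ n)
          atTop (𝓝 0) := by
        have h1 := ((Real.continuous_exp.tendsto 0).comp hnθ).sub_const 1
        simpa using h1.add htail0
      refine BVS.tendstoInMeasure_of_abs_sub_le hG hb ?_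
      filter_upwards [eventually_ge_atTop 1, hodds hδ', htail hδ0, hτ0]
        with n hn ho ht hτn ω hω
      have h1 := BVS.abs_posteriorProb_sub_one_le hn hω.1 hν (hφpos n hn) (θ := θ n) (τ := τ n)
        (by positivity) hτn (fun γ => (ho ω hω γ).1) (fun γ => (ho ω hω γ).2)
      linarith
  · have hodds : ∀ᶠ n : ℕ in atTop, ∀ ω ∈ G n, (n : ℝ) ≤
        BVS.posteriorOdds ν (fun _ => φ n) (BVS.flatPrior n) (X n ω) (X n ω *ᵥ β₀ n + ε n ω)
          (BVS.stateVector (β₀ n)) ∅ := by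
      filter_upwards [eventually_ge_atTop 1, hcard, hβsum,
        BVS.eventually_dispersion_bound_le hc₁ (by linarith : 0 < δ₁) hC,
        BVS.eventually_natCast_le_sqrt_mul_rpow hν (by linarith : 0 < 5 + δ₁) hφ hφO]
        with n hn hs' hsum hR hbig ω hω
      rw [← hψ n] at hR
      exact hbig.trans (BVS.posteriorOdds_empty_ge hn hω.1 hν (hφ n hn) hω.2 hsum
        (Finset.card_pos.1 (hs' ▸ hs)) hR)
    refine ⟨BVS.tendstoInProbAtTop_of_le hG tendsto_natCast_atTop_atTop hodds,
      BVS.tendstoInMeasure_of_abs_sub_le hG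
        (tendsto_inv_atTop_zero.comp tendsto_natCast_atTop_atTop) ?_⟩
    filter_upwards [eventually_ge_atTop 1, hodds] with n hn ho ω hω
    have hn0 : (0 : ℝ) < n := by positivity
    rw [sub_zero, abs_of_nonneg (BVS.posteriorProb_nonneg hn hω.1 hν (hφ n hn) _ _)]
    exact (BVS.posteriorProb_le_inv_posteriorOdds hn hω.1 hν (hφ n hn) _ ∅).trans
      (inv_anti₀ hn0 (ho ω hω))
  · have hd : Tendsto (fun n : ℕ => (1 + n * φ n) / (n : ℝ) ^ 2) atTop (𝓝 0) := by
      simpa [div_eq_mul_inv] using (hlim.const_add 1).mul BVS.tendsto_inv_natCast_sq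
    filter_upwards [hXae] with ω hω
    refine ⟨?_, hpost_zero φ hφ hd ω hω⟩
    have h1 : Tendsto (fun n : ℕ => (√(1 + n * φ n))⁻¹) atTop (𝓝 ((1 + η) ^ (-(1 / 2) : ℝ))) := by
      rw [Real.rpow_neg (by linarith), ← Real.sqrt_eq_rpow]
      exact (hlim.const_add 1).sqrt.inv₀ (Real.sqrt_pos.2 (by linarith)).ne'
    have hb := (continuous_coe_real_ereal.tendsto _).comp h1
    rw [← hb.liminf_eq]
    refine liminf_le_liminf ?_
    filter_upwards [eventually_ge_atTop 1, eventually_gt_atTop s, hcard] with n hn hsn hs'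
    exact EReal.coe_le_coe_iff.2
      (BVS.inv_sqrt_le_maxPosteriorOdds hn (hω n) hν (hφ n hn) _ (hs' ▸ hsn))
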